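/- All graphs are finite, simple and connected. For vertices $u,v$ of a graph $G$ let $d(u,v)$ be their distance, and for an edge $e=uv$ and a vertex $s$ let $d(e,s)=\min\{d(u,s),d(v,s)\}$. The metric dimension $\dim(G)$ (resp. the edge metric dimension $\mathrm{edim}(G)$) is the smallest cardinality of a set $S\subseteq V(G)$ such that for any two distinct vertices (resp. edges) $x,x'$ of $G$ there is $s\in S$ with $d(x,s)\neq d(x',s)$. A thread attached to a vertex $v$ with $\deg(v)\ge 3$ is a path $u_1u_2\cdots u_k$ ($k\ge 1$) such that $u_1$ is a neighbour of $v$, the vertices $u_1,\dots,u_{k-1}$ have degree $2$ in $G$ and $u_k$ has degree $1$ in $G$. Let $\ell(v)$ be the number of threads attached to $v$ and $$L(G)=\sum_{v\in V(G),\ \ell(v)>1}(\ell(v)-1).$$ $G$ is a cactus graph if any two distinct cycles of $G$ are edge disjoint. For a cycle $C$ of $G$ and $v\in V(C)$, let $T_v$ be the connected component of $G-E(C)$ containing $v$. The vertex $v$ is branch-active on $C$ if $T_v$ contains a vertex $w$ such that either $w\notin V(C)$ and $\deg_G(w)\ge 3$, or $w\in V(C)$ and $\deg_G(w)\ge 4$.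 Let $b(C)$ be the number of branch-active vertices on $C$. Lemma. Let $G$ be a cactus graph with exactly $c\geq 0$ cycles $C_1,\dots,C_c$, and suppose that $G$ is not a path on at least two vertices. Then $$\dim(G)\le L(G)+\sum_{i=1}^{c}\max\{2-b(C_i),0\}+c \quad\text{and}\quad \mathrm{edim}(G)\le L(G)+\sum_{i=1}^{c}\max\{2-b(C_i),0\}+c .$$ -/

import Mathlib

/-! # Vertex and edge metric dimension of cactus graphs -/

namespace CactusDim

variable {V : Type*}

/-! ## Metric generators and metric dimensions -/

/-- `S` is a (vertex) metric generator of `G`: any two distinct vertices are at different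
distances from some `s ∈ S`. -/
def IsMetricGenerator (G : SimpleGraph V) (S : Finset V) : Prop :=
  ∀ u v : V, u ≠ v → ∃ s ∈ S, G.dist u s ≠ G.dist v s

/-- The distance `d(e, s) = min {d(u, s), d(v, s)}` from an edge `e = uv` to a vertex `s`. -/
noncomputable def edgeDist (G : SimpleGraph V) (e : Sym2 V) (s : V) : ℕ :=
  Sym2.lift ⟨fun u v => min (G.dist u s) (G.dist v s), fun _ _ => min_comm _ _⟩ e

/-- `S` is an edge metric generator of `G`: any two distinct edges are at different distances
from some `s ∈ S`. -/
def IsEdgeMetricGenerator (G : SimpleGraph V) (S : Finset V) : Prop :=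
  ∀ e ∈ G.edgeSet, ∀ f ∈ G.edgeSet, e ≠ f → ∃ s ∈ S, edgeDist G e s ≠ edgeDist G f s

/-- The (vertex) metric dimension `dim(G)`: the smallest cardinality of a metric generator. -/
noncomputable def metricDim (G : SimpleGraph V) : ℕ :=
  sInf {n : ℕ | ∃ S : Finset V, IsMetricGenerator G S ∧ S.card = n}

/-- The edge metric dimension `edim(G)`: the smallest cardinality of an edge metric generator. -/
noncomputable def edgeMetricDim (G : SimpleGraph V) : ℕ :=
  sInf {n : ℕ | ∃ S : Finset V, IsEdgeMetricGenerator G S ∧ S.card = n}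

/-- In a finite connected graph the infimum defining `metricDim` is a minimum. -/
theorem exists_metricGenerator_card_eq [Fintype V] (G : SimpleGraph V) (hG : G.Connected) :
    ∃ S : Finset V, IsMetricGenerator G S ∧ S.card = metricDim G := by
  refine Nat.sInf_mem (s := {n : ℕ | ∃ S : Finset V, IsMetricGenerator G S ∧ S.card = n})
    ⟨_, Finset.univ, ?_, rfl⟩
  intro u v huv
  refine ⟨u, Finset.mem_univ u, ?_⟩
  rw [SimpleGraph.dist_self]
  exact (hG.pos_dist_of_ne huv.symm).ne

/-- In a finite connected graph the infimum defining `edgeMetricDim` is a minimum. -/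
theorem exists_edgeMetricGenerator_card_eq [Fintype V] (G : SimpleGraph V) (hG : G.Connected) :
    ∃ S : Finset V, IsEdgeMetricGenerator G S ∧ S.card = edgeMetricDim G := by
  have key : ∀ (e : Sym2 V) (s : V), edgeDist G e s = 0 ↔ s ∈ e := by
    intro e s
    induction e with
    | _ a b =>
      have ha := hG.dist_eq_zero_iff (u := a) (v := s)
      have hb := hG.dist_eq_zero_iff (u := b) (v := s)
      simp only [edgeDist, Sym2.lift_mk, Sym2.mem_iff, Nat.min_eq_zero_iff, ha, hb,
        eq_comm (a := s)]
  refine Nat.sInf_mem (s := {n : ℕ | ∃ S : Finset V, IsEdgeMetricGenerator G S ∧ S.card = n})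
    ⟨_, Finset.univ, ?_, rfl⟩
  intro e _ f _ hef
  by_contra! h
  refine hef (Sym2.ext fun s => ?_)
  rw [← key, ← key, h s (Finset.mem_univ s)]

/-! ## Threads and `L(G)` -/

/-- The list `l = [u₁, …, u_k]` (`k ≥ 1`) is a thread attached to `v`: `v` has degree at least 3,
`u₁` is a neighbour of `v`, `u₁ u₂ ⋯ u_k` is a path in `G`, the vertices `u₁, …, u_{k-1}` have
degree 2, and `u_k` has degree 1. -/
def IsThreadAt (G : SimpleGraph V) [G.LocallyFinite] (v : V) (l : List V) : Prop :=
  3 ≤ G.degree v ∧ (v :: l).IsChain G.Adj ∧ l.Nodup ∧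
    (∀ u ∈ l.dropLast, G.degree u = 2) ∧ ∃ w ∈ l.getLast?, G.degree w = 1

/-- `ℓ(v)`: the number of threads attached to `v`. -/
noncomputable def numThreads (G : SimpleGraph V) [G.LocallyFinite] (v : V) : ℕ :=
  {l : List V | IsThreadAt G v l}.ncard

/-- `L(G)`: the sum of `ℓ(v) - 1` over all vertices `v` with `ℓ(v) > 1`. -/
noncomputable def threadExcess [Fintype V] (G : SimpleGraph V) [G.LocallyFinite] : ℕ :=
  ∑ v : V with 1 < numThreads G v, (numThreads G v - 1)

/-! ## Cycles and cactus graphs -/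

/-- The subgraph `C` of `G` is a cycle. -/
def IsCycleSubgraph (G : SimpleGraph V) (C : G.Subgraph) : Prop :=
  ∃ (v : V) (p : G.Walk v v), p.IsCycle ∧ p.toSubgraph = C

/-- The finite set of all cycles of a finite graph `G`. -/
noncomputable def cycles [Finite V] (G : SimpleGraph V) : Finset G.Subgraph :=
  (Set.toFinite {C : G.Subgraph | IsCycleSubgraph G C}).toFinset

/-- `G` is a cactus graph: it is connected and any two distinct cycles are edge disjoint. -/
def IsCactus (G : SimpleGraph V) : Prop :=
  G.Connected ∧ ∀ C D : G.Subgraph, IsCycleSubgraph G C → IsCycleSubgraph G D → C ≠ D →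
    Disjoint C.edgeSet D.edgeSet

/-! ## Branch-active vertices and `b(C)` -/

/-- `w` is a branching vertex with respect to the cycle `C`: either `w` is not on `C` and
`deg(w) ≥ 3`, or `w` is on `C` and `deg(w) ≥ 4` (degrees in `G`). -/
def IsBranching (G : SimpleGraph V) [G.LocallyFinite] (C : G.Subgraph) (w : V) : Prop :=
  (w ∉ C.verts ∧ 3 ≤ G.degree w) ∨ (w ∈ C.verts ∧ 4 ≤ G.degree w)

/-- `v ∈ V(C)` is branch-active on `C`: the connected component `T_v` of `G - E(C)` containing
`v` contains a branching vertex. -/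
def IsBranchActive (G : SimpleGraph V) [G.LocallyFinite] (C : G.Subgraph) (v : V) : Prop :=
  v ∈ C.verts ∧ ∃ w : V, (G.deleteEdges C.edgeSet).Reachable v w ∧ IsBranching G C w

/-- `b(C)`: the number of branch-active vertices on `C`. -/
noncomputable def numBranchActive (G : SimpleGraph V) [G.LocallyFinite] (C : G.Subgraph) : ℕ :=
  {v : V | IsBranchActive G C v}.ncard

end CactusDim

namespace CactusDim

open SimpleGraph

/-! ## Blocks -/

/-! One set `S` of the required size serves for both dimensions. It is any set that meets all but at
most one of the threads at each vertex (`MeetsThreads`, cost `L(G)`) and that, on each cycle,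
contains all vertices of some geodesic triple that are not branch-active (`HasTriples`). Two
positions of the triple can be prescribed, hence chosen branch-active as far as possible, so a cycle
costs at most `3 - min (b, 2) = max (2 - b, 0) + 1`.

Bridges and cycles are treated alike as blocks. Deleting the edges of a block leaves one piece at
each of its vertices, and the block vertex of the piece of `x` is the gate of `x`. The central lemma
`IsBlock.exists_isTail` says that a piece avoiding `S` is a path. A branch-active vertex never
carries such a piece, so every position of a triple is the gate of some element of `S`
(`exists_gate_triple`).

Distances to three elements with gates in a geodesic triple determine the gate of a vertex
(`IsGeodesicTriple.resolves`). Undistinguished vertices `x, x'` therefore have the same gate on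
every cycle, and every geodesic between them consists of bridges. An element of `S` attached to such
a geodesic off its centre is nearer to one end. If there were none, both halves would end in
`S`-free paths, giving either two threads at the centre that `S` misses, or a graph that is a path
(`exists_off_centre`). Edges are handled in the same way, by their midpoints on a subdivided cycle
and then by their endpoints that are farthest apart. -/

/-- The edges of the closed walk `c 0, c 1, …`. -/
def blockEdges {V : Type*} (c : ℕ → V) : Set (Sym2 V) := Set.range fun k => s(c k, c (k + 1))

/-- A bridge (`n = 2`) or a cycle of length `n ≥ 3` whose vertices lie in different components
after removal of its edges, as an `n`-periodic sequence of vertices. -/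
structure IsBlock {V : Type*} (G : SimpleGraph V) (n : ℕ) (c : ℕ → V) : Prop where
  two_le : 2 ≤ n
  periodic : ∀ k, c (k + n) = c k
  adj : ∀ k, G.Adj (c k) (c (k + 1))
  sep : ∀ i j, (G.deleteEdges (blockEdges c)).Reachable (c i) (c j) → i % n = j % n
  cycle : 3 ≤ n → ∃ C : G.Subgraph, IsCycleSubgraph G C ∧ C.verts = Set.range c ∧
    C.edgeSet = blockEdges c

theorem succ_mod_eq (n k : ℕ) (hn : 2 ≤ n) :
    (k + 1) % n = if k % n + 1 = n then 0 else k % n + 1 := by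
  have := Nat.mod_lt k (by omega : n > 0)
  rw [Nat.add_mod_eq_ite, Nat.mod_eq_of_lt (a := 1) (by omega)]
  split_ifs <;> omega

/-- Only `sep` uses the cactus property: a connection between two vertices of the cycle off its
edges would close up with an arc of the cycle to a second cycle sharing an edge with the first. -/
theorem exists_block_of_isCycleSubgraph {V : Type*} {G : SimpleGraph V} (hG : IsCactus G)
    {C : G.Subgraph} (hC : IsCycleSubgraph G C) :
    ∃ n c, IsBlock G n c ∧ 3 ≤ n ∧ C.verts = Set.range c ∧ C.edgeSet = blockEdges c := by
  classical
  have hC' := hC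
  obtain ⟨v, p, hp, rfl⟩ := hC
  set n := p.length with hn
  have h3 : 3 ≤ n := hp.three_le_length
  set c : ℕ → V := fun k => p.getVert (k % n) with hc
  have hlt : ∀ k, k % n < n := fun k => Nat.mod_lt k (by omega)
  have hsucc : ∀ k, c (k + 1) = p.getVert (k % n + 1) := by
    intro k
    simp only [hc]
    rw [succ_mod_eq n k (by omega)]
    split_ifs with h
    · rw [h, p.getVert_zero, hn, p.getVert_length]
    · rfl
  have hadj : ∀ k, G.Adj (c k) (c (k + 1)) := by
    intro k
    rw [hsucc]
    exact p.adj_getVert_succ (hlt k)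
  have hinj : ∀ i j, c i = c j → i % n = j % n := by
    intro i j h
    have h1 := hlt i
    have h2 := hlt j
    exact hp.getVert_injOn' (by simp; omega) (by simp; omega) h
  have hverts : p.toSubgraph.verts = Set.range c := by
    ext x
    rw [Walk.mem_verts_toSubgraph, Walk.mem_support_iff_exists_getVert]
    constructor
    · rintro ⟨k, rfl, hk⟩
      rcases hk.lt_or_eq with h | h
      · exact ⟨k, by simp only [hc]; rw [Nat.mod_eq_of_lt (hn ▸ h)]⟩
      · exact ⟨0, by rw [h, p.getVert_length]; simp [hc]⟩
    · rintro ⟨k, rfl⟩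
      exact ⟨k % n, rfl, (hlt k).le⟩
  have hedges : p.toSubgraph.edgeSet = blockEdges c := by
    ext e
    induction e with
    | _ a b =>
    rw [Subgraph.mem_edgeSet, Walk.toSubgraph_adj_iff]
    constructor
    · rintro ⟨k, hk, hl⟩
      refine ⟨k, ?_⟩
      simp only
      rw [hsucc]
      simp only [hc]
      rw [Nat.mod_eq_of_lt (hn ▸ hl), hk]
    · rintro ⟨k, hk⟩
      refine ⟨k % n, ?_, hlt k⟩
      simp only at hk
      rw [hsucc] at hk
      exact hk
  have hinjE : ∀ k l, s(c k, c (k + 1)) = s(c l, c (l + 1)) → k % n = l % n := by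
    intro k l h
    rw [Sym2.eq_iff] at h
    rcases h with ⟨h, _⟩ | ⟨h1, h2⟩
    · exact hinj _ _ h
    · have h1 := hinj _ _ h1
      have h2 := hinj _ _ h2
      rw [succ_mod_eq n _ (by omega)] at h1 h2
      have := hlt k
      have := hlt l
      split_ifs at h1 h2 <;> omega
  have key : ∀ i j, i < j → j < n → ¬ (G.deleteEdges (blockEdges c)).Reachable (c i) (c j) := by
    intro i j hij hj hr
    set e := s(c i, c (i + 1)) with he
    set f := s(c j, c (j + 1)) with hf
    have hmod : ∀ k, k < n → k % n = k := fun k hk => Nat.mod_eq_of_lt hk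
    have hef : ∀ k, k < n → k ≠ j → s(c k, c (k + 1)) ≠ f := by
      intro k hk hkj h
      have := hinjE _ _ h
      rw [hmod k hk, hmod j hj] at this
      exact hkj this
    have hee : ∀ k, k < n → k ≠ i → s(c k, c (k + 1)) ≠ e := by
      intro k hk hkj h
      have := hinjE _ _ h
      rw [hmod k hk, hmod i (by omega)] at this
      exact hkj this
    -- In `G - f` the arc from `c (i + 1)` to `c j` and the outside connection from `c j` to `c i`
    -- put `e` on a cycle. That cycle misses `f`, so it differs from the given one although both
    -- contain `e`.
    set H := G.deleteEdges {f} with hH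
    have hHadj : H.Adj (c i) (c (i + 1)) := by
      rw [hH, deleteEdges_adj]
      exact ⟨hadj i, hef i (by omega) (by omega)⟩
    have hreach : ∀ m, i + 1 + m ≤ j →
        (H.deleteEdges {e}).Reachable (c (i + 1)) (c (i + 1 + m)) := by
      intro m
      induction m with
      | zero => intro _; exact Reachable.refl _
      | succ m ih =>
        intro hm
        refine (ih (by omega)).trans (Adj.reachable ?_)
        rw [deleteEdges_adj, hH, deleteEdges_adj]
        exact ⟨⟨hadj _, hef _ (by omega) (by omega)⟩, hee _ (by omega) (by omega)⟩
    have h1 : (H.deleteEdges {e}).Reachable (c i) (c j) := by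
      refine hr.mono ?_
      intro a b hab
      rw [deleteEdges_adj] at hab
      rw [deleteEdges_adj, hH, deleteEdges_adj]
      refine ⟨⟨hab.1, ?_⟩, ?_⟩
      · rintro h; exact hab.2 ⟨j, h.symm⟩
      · rintro h; exact hab.2 ⟨i, h.symm⟩
    have h2 := hreach (j - (i + 1)) (by omega)
    rw [show i + 1 + (j - (i + 1)) = j by omega] at h2
    obtain ⟨u, q, hq, heq⟩ := adj_and_reachable_delete_edges_iff_exists_cycle.1
      ⟨hHadj, h1.trans h2.symm⟩
    have hle : H ≤ G := deleteEdges_le _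
    set D := (q.mapLe hle).toSubgraph with hD
    have hDc : IsCycleSubgraph G D := ⟨u, q.mapLe hle, hq.mapLe hle, rfl⟩
    have heD : e ∈ D.edgeSet := by
      rw [hD, Walk.mem_edges_toSubgraph, Walk.edges_mapLe_eq_edges]; exact heq
    have hfD : f ∉ D.edgeSet := by
      rw [hD, Walk.mem_edges_toSubgraph, Walk.edges_mapLe_eq_edges]
      intro h
      have := q.edges_subset_edgeSet h
      rw [hH, edgeSet_deleteEdges] at this
      exact this.2 rfl
    have heC : e ∈ p.toSubgraph.edgeSet := by rw [hedges]; exact ⟨i, rfl⟩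
    have hfC : f ∈ p.toSubgraph.edgeSet := by rw [hedges]; exact ⟨j, rfl⟩
    have hne : p.toSubgraph ≠ D := by
      intro h; rw [h] at hfC; exact hfD hfC
    exact Set.disjoint_left.1 (hG.2 _ _ hC' hDc hne) heC heD
  refine ⟨n, c, ⟨by omega, ?_, hadj, ?_, fun _ => ⟨_, hC', hverts, hedges⟩⟩, h3, hverts, hedges⟩
  · intro k; simp [hc]
  · intro i j hr
    have hi : c i = c (i % n) := by simp [hc]
    have hj : c j = c (j % n) := by simp [hc]
    rw [hi, hj] at hr
    rcases lt_trichotomy (i % n) (j % n) with h | h | h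
    · exact absurd hr (key _ _ h (hlt j))
    · exact h
    · exact absurd hr.symm (key _ _ h (hlt i))

theorem exists_block_of_isBridge {V : Type*} {G : SimpleGraph V} {u v : V}
    (ha : G.Adj u v) (h : G.IsBridge s(u, v)) :
    ∃ c, IsBlock G 2 c ∧ c 0 = u ∧ c 1 = v := by
  set c : ℕ → V := fun k => if k % 2 = 0 then u else v with hc
  have hE : blockEdges c = {s(u, v)} := by
    ext e
    constructor
    · rintro ⟨k, rfl⟩
      rcases Nat.mod_two_eq_zero_or_one k with h0 | h0
      · simp [hc, h0, Nat.add_mod]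
      · simp [hc, h0, Nat.add_mod, Sym2.eq_swap]
    · rintro rfl
      exact ⟨0, by simp [hc]⟩
  rw [isBridge_iff] at h
  refine ⟨c, ⟨le_rfl, fun k => by simp [hc], fun k => ?_, fun i j hr => ?_,
    fun h3 => absurd h3 (by norm_num)⟩, by simp [hc], by simp [hc]⟩
  · rcases Nat.mod_two_eq_zero_or_one k with h0 | h0
    · simp [hc, h0, Nat.add_mod, ha]
    · simp [hc, h0, Nat.add_mod, ha.symm]
  · rw [hE] at hr
    rcases Nat.mod_two_eq_zero_or_one i with h0 | h0 <;>
      rcases Nat.mod_two_eq_zero_or_one j with h1 | h1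
    · omega
    · simp only [hc, h0, h1] at hr
      exact absurd hr h
    · simp only [hc, h0, h1] at hr
      exact absurd hr.symm h
    · omega

section Blocks

variable {V : Type*} {G : SimpleGraph V} {n m : ℕ} {c d : ℕ → V}

/-- `G` without the edges of a block. -/
abbrev offBlock (G : SimpleGraph V) (c : ℕ → V) : SimpleGraph V := G.deleteEdges (blockEdges c)

theorem IsBlock.apply_mod (h : IsBlock G n c) (k : ℕ) : c (k % n) = c k := by
  have : ∀ q r, c (r + n * q) = c r := by
    intro q
    induction q with
    | zero => simp
    | succ q ih => intro r; rw [Nat.mul_succ, ← Nat.add_assoc, h.periodic, ih]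
  conv_rhs => rw [← Nat.mod_add_div k n]
  rw [this]

theorem IsBlock.pos (h : IsBlock G n c) : 0 < n := by have := h.two_le; omega

theorem IsBlock.mod_eq_of_eq (h : IsBlock G n c) {i j : ℕ} (hij : c i = c j) : i % n = j % n :=
  h.sep i j (hij ▸ Reachable.refl _)

theorem IsBlock.blockEdges_eq (h : IsBlock G 2 c) (k : ℕ) :
    blockEdges c = {s(c k, c (k + 1))} := by
  ext e
  constructor
  · rintro ⟨l, rfl⟩
    simp only [Set.mem_singleton_iff]
    rw [← h.apply_mod k, ← h.apply_mod (k + 1), ← h.apply_mod l, ← h.apply_mod (l + 1),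
      succ_mod_eq 2 l le_rfl, succ_mod_eq 2 k le_rfl]
    rcases Nat.mod_two_eq_zero_or_one k with h0 | h0 <;>
      rcases Nat.mod_two_eq_zero_or_one l with h1 | h1 <;> simp [h0, h1, Sym2.eq_swap]
  · rintro rfl
    exact ⟨k, rfl⟩

theorem IsBlock.isBridge (h : IsBlock G 2 c) (k : ℕ) : G.IsBridge s(c k, c (k + 1)) := by
  rw [isBridge_iff]
  intro hr
  rw [← h.blockEdges_eq k] at hr
  have := h.sep _ _ hr
  omega

/-- Distinct cycles of a cactus are edge disjoint and a bridge lies on no cycle, so blocks partition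
the edges. -/
theorem IsBlock.blockEdges_eq_of_mem (hG : IsCactus G) (h : IsBlock G n c) (h' : IsBlock G m d)
    {e : Sym2 V} (he : e ∈ blockEdges c) (he' : e ∈ blockEdges d) :
    blockEdges c = blockEdges d := by
  have aux : ∀ {m : ℕ} {c d : ℕ → V}, IsBlock G 2 c → IsBlock G m d → e ∈ blockEdges c →
      e ∈ blockEdges d → 3 ≤ m → False := by
    intro m c d h h' he he' hm
    obtain ⟨C, ⟨v, p, hp, rfl⟩, -, hE⟩ := h'.cycle hm
    rw [← hE, Walk.mem_edges_toSubgraph] at he'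
    obtain ⟨k, rfl⟩ := he
    exact (h.isBridge k).notMem_edges_of_isCycle hp he'
  rcases h.two_le.lt_or_eq with hn | hn <;> rcases h'.two_le.lt_or_eq with hm | hm
  · obtain ⟨C, hC, -, hE⟩ := h.cycle hn
    obtain ⟨D, hD, -, hE'⟩ := h'.cycle hm
    rw [← hE, ← hE']
    by_contra hne
    have : C ≠ D := fun h => hne (by rw [h])
    exact Set.disjoint_left.1 (hG.2 C D hC hD this) (hE ▸ he) (hE' ▸ he')
  · subst hm
    exact (aux h' h he' he hn).elim
  · subst hn
    exact (aux h h' he he' hm).elim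
  · subst hn hm
    obtain ⟨k, rfl⟩ := he
    obtain ⟨l, hl⟩ := he'
    rw [h.blockEdges_eq k, h'.blockEdges_eq l]
    simp only at hl
    rw [hl]

theorem exists_block_of_adj (hG : IsCactus G) {u v : V} (ha : G.Adj u v) :
    ∃ n c, IsBlock G n c ∧ s(u, v) ∈ blockEdges c := by
  by_cases hb : G.IsBridge s(u, v)
  · obtain ⟨c, hc, rfl, rfl⟩ := exists_block_of_isBridge ha hb
    exact ⟨2, c, hc, 0, rfl⟩
  · rw [isBridge_iff_forall_cycle_notMem ha] at hb
    push Not at hb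
    obtain ⟨w, p, hp, he⟩ := hb
    obtain ⟨n, c, hc, -, -, hE⟩ := exists_block_of_isCycleSubgraph hG ⟨w, p, hp, rfl⟩
    exact ⟨n, c, hc, by rwa [← hE, Walk.mem_edges_toSubgraph]⟩

theorem adj_cases_of_mem_blockEdges {u v : V} (he : s(u, v) ∈ blockEdges c) :
    ∃ k, (u = c k ∧ v = c (k + 1)) ∨ (u = c (k + 1) ∧ v = c k) := by
  obtain ⟨k, hk⟩ := he
  refine ⟨k, ?_⟩
  simp only [Sym2.eq_iff] at hk
  rcases hk with ⟨h1, h2⟩ | ⟨h1, h2⟩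
  · exact Or.inl ⟨h1.symm, h2.symm⟩
  · exact Or.inr ⟨h2.symm, h1.symm⟩

/-- Two blocks with disjoint edges: the vertices of one are connected outside the other. -/
theorem IsBlock.reachable_offBlock (h : IsBlock G n c) (hd : Disjoint (blockEdges c) (blockEdges d))
    (i j : ℕ) : (offBlock G d).Reachable (c i) (c j) := by
  have : ∀ i, (offBlock G d).Reachable (c 0) (c i) := by
    intro i
    induction i with
    | zero => exact Reachable.refl _
    | succ i ih =>
      refine ih.trans (Adj.reachable ?_)
      rw [deleteEdges_adj]
      exact ⟨h.adj i, Set.disjoint_left.1 hd ⟨i, rfl⟩⟩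
  exact (this i).symm.trans (this j)

/-- A piece at a block `d` hanging off a vertex of `d` other than `d b = c a` lies in the piece
at the block `c` of `c a`. -/
theorem IsBlock.reachable_of_disjoint (h : IsBlock G n c) (h' : IsBlock G m d)
    (hd : Disjoint (blockEdges c) (blockEdges d)) {a b j : ℕ} (hab : c a = d b)
    (hj : j % m ≠ b % m) {z : V} (hz : (offBlock G d).Reachable (d j) z) :
    (offBlock G c).Reachable (c a) z := by
  have h1 : (offBlock G c).Reachable (c a) (d j) := by
    rw [hab]; exact h'.reachable_offBlock hd.symm _ _
  have hz' := hz
  rw [reachable_iff_reflTransGen] at hz'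
  induction hz' with
  | refl => exact h1
  | @tail w x hw hwx ih =>
    have hw' : (offBlock G d).Reachable (d j) w := (reachable_iff_reflTransGen _ _).2 hw
    refine (ih hw').trans (Adj.reachable ?_)
    rw [deleteEdges_adj] at hwx ⊢
    -- A first edge of `c` on the walk would start at a vertex of `c`. All of these are joined off
    -- `d` to `c a = d b`, so `d j` would lie in the piece of `d b`.
    refine ⟨hwx.1, fun he => hj ?_⟩
    have : ∃ k, w = c k := by
      obtain ⟨k, hk | hk⟩ := adj_cases_of_mem_blockEdges he
      · exact ⟨k, hk.1⟩
      · exact ⟨k + 1, hk.1⟩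
    obtain ⟨k, rfl⟩ := this
    refine h'.sep _ _ (hw'.trans ?_)
    rw [← hab]
    exact h.reachable_offBlock hd _ _

/-! ## Gates and distances -/

/-- The index of the vertex of the block `c` from which `x` is reachable off the block. -/
noncomputable def gate (G : SimpleGraph V) (c : ℕ → V) (x : V) : ℕ :=
  sInf {k | (offBlock G c).Reachable (c k) x}

theorem gate_nonempty (hG : G.Connected) (c : ℕ → V) (x : V) :
    {k | (offBlock G c).Reachable (c k) x}.Nonempty := by
  have hx := (reachable_iff_reflTransGen _ _).1 (hG.preconnected (c 0) x)
  induction hx with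
  | refl => exact ⟨0, Reachable.refl _⟩
  | @tail w x _ hwx ih =>
    obtain ⟨k, hk⟩ := ih
    by_cases he : s(w, x) ∈ blockEdges c
    · obtain ⟨l, hl | hl⟩ := adj_cases_of_mem_blockEdges he
      · exact ⟨l + 1, by rw [hl.2]; exact Reachable.refl _⟩
      · exact ⟨l, by rw [hl.2]; exact Reachable.refl _⟩
    · refine ⟨k, Reachable.trans hk (Adj.reachable ?_)⟩
      rw [deleteEdges_adj]
      exact ⟨hwx, he⟩

theorem gate_reachable (hG : G.Connected) (c : ℕ → V) (x : V) :
    (offBlock G c).Reachable (c (gate G c x)) x :=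
  Nat.sInf_mem (gate_nonempty hG c x)

theorem IsBlock.gate_lt (h : IsBlock G n c) (hG : G.Connected) (x : V) : gate G c x < n := by
  refine lt_of_le_of_lt (Nat.sInf_le ?_) (Nat.mod_lt (gate G c x) h.pos)
  simp only [Set.mem_ofPred_eq]
  rw [h.apply_mod]
  exact gate_reachable hG c x

theorem IsBlock.gate_eq_of_reachable (h : IsBlock G n c) (hG : G.Connected) {x : V} {k : ℕ}
    (hr : (offBlock G c).Reachable (c k) x) : gate G c x = k % n := by
  have := h.sep _ _ ((gate_reachable hG c x).trans hr.symm)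
  rwa [Nat.mod_eq_of_lt (h.gate_lt hG x)] at this

theorem IsBlock.gate_apply (h : IsBlock G n c) (hG : G.Connected) (k : ℕ) :
    gate G c (c k) = k % n :=
  h.gate_eq_of_reachable hG (Reachable.refl _)

theorem IsBlock.reachable_of_gate_eq (h : IsBlock G n c) (hG : G.Connected) {x : V} {k : ℕ}
    (hk : gate G c x = k % n) : (offBlock G c).Reachable (c k) x := by
  rw [← h.apply_mod k, ← hk]
  exact gate_reachable hG c x

theorem IsBlock.gate_eq_of_adj (h : IsBlock G n c) (hG : G.Connected) {x y : V}
    (ha : G.Adj x y) (he : s(x, y) ∉ blockEdges c) : gate G c x = gate G c y := by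
  have : (offBlock G c).Adj x y := by rw [deleteEdges_adj]; exact ⟨ha, he⟩
  rw [h.gate_eq_of_reachable hG ((gate_reachable hG c y).trans this.symm.reachable),
    Nat.mod_eq_of_lt (h.gate_lt hG y)]

/-- Distance on a cycle of length `n` between positions `i, j < n`. -/
def cyc (n i j : ℕ) : ℕ := min ((i - j) + (j - i)) (n - ((i - j) + (j - i)))

theorem cyc_self (n i : ℕ) : cyc n i i = 0 := by simp [cyc]

theorem cyc_comm (n i j : ℕ) : cyc n i j = cyc n j i := by
  simp only [cyc, Nat.add_comm]

theorem le_add_dist_of_lipschitz (hG : G.Connected) {f : V → ℕ}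
    (hf : ∀ u v, G.Adj u v → f u ≤ f v + 1) (u v : V) : f u ≤ f v + G.dist u v := by
  obtain ⟨p, hp⟩ := hG.exists_walk_length_eq_dist u v
  rw [← hp]
  clear hp
  induction p with
  | nil => simp
  | cons h p ih =>
    have := hf _ _ h
    rw [Walk.length_cons]
    omega

theorem dist_le_succ_of_adj (hG : G.Connected) {u v : V} (h : G.Adj u v) (w : V) :
    G.dist u w ≤ G.dist v w + 1 := by
  have := hG.dist_triangle (u := u) (v := v) (w := w)
  rw [dist_eq_one_iff_adj.2 h] at this
  omega

theorem IsBlock.dist_apply_le (h : IsBlock G n c) (hG : G.Connected) {i j : ℕ}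
    (hi : i < n) (hj : j < n) : G.dist (c i) (c j) ≤ cyc n i j := by
  have step : ∀ i m, G.dist (c i) (c (i + m)) ≤ m := by
    intro i m
    induction m with
    | zero => simp
    | succ m ih =>
      have := hG.dist_triangle (u := c i) (v := c (i + m)) (w := c (i + m + 1))
      rw [dist_eq_one_iff_adj.2 (h.adj (i + m))] at this
      rw [← Nat.add_assoc]
      omega
  have main : ∀ i j, i ≤ j → j < n → G.dist (c i) (c j) ≤ cyc n i j := by
    intro i j hij hj
    have h1 := step i (j - i)
    have h2 := step j (n - (j - i))
    rw [show i + (j - i) = j by omega] at h1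
    rw [show j + (n - (j - i)) = i + n by omega, h.periodic, SimpleGraph.dist_comm] at h2
    simp only [cyc]
    omega
  rcases le_total i j with hij | hij
  · exact main i j hij hj
  · rw [dist_comm, cyc_comm]; exact main j i hij hi

theorem cyc_succ_mod (hn : 2 ≤ n) {k g : ℕ} (hg : g < n) :
    cyc n (k % n) g ≤ cyc n ((k + 1) % n) g + 1 ∧ cyc n ((k + 1) % n) g ≤ cyc n (k % n) g + 1 := by
  rw [succ_mod_eq n k hn]
  have := Nat.mod_lt k (by omega : n > 0)
  generalize k % n = r at *
  simp only [cyc]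
  split_ifs <;> omega

/-- The distance between vertices in different pieces at a block. -/
theorem IsBlock.dist_eq (h : IsBlock G n c) (hG : G.Connected) {x s : V}
    (hxs : gate G c x ≠ gate G c s) :
    G.dist x s = G.dist x (c (gate G c x)) + cyc n (gate G c x) (gate G c s)
      + G.dist (c (gate G c s)) s := by
  have hgc := h.gate_apply hG
  have hgx := h.gate_lt hG x
  have hgs := h.gate_lt hG s
  have hadj := fun u v => h.gate_eq_of_adj hG (x := u) (y := v)
  generalize gate G c = g at *
  apply le_antisymm
  · have h1 := hG.dist_triangle (u := x) (v := c (g x)) (w := s)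
    have h2 := hG.dist_triangle (u := c (g x)) (v := c (g s)) (w := s)
    have h3 := h.dist_apply_le hG hgx hgs
    omega
  -- A function that changes by at most 1 along edges and vanishes at `s` is a lower bound for the
  -- distance to `s`. The claimed formula becomes one when it is replaced by the true distance on
  -- the piece of `s`.
  · set f : V → ℕ := fun y => if g y = g s then G.dist y s
      else G.dist y (c (g y)) + cyc n (g y) (g s) + G.dist (c (g s)) s with hf
    have hfc : ∀ k, f (c k) = cyc n (k % n) (g s) + G.dist (c (g s)) s := by
      intro k
      simp only [hf]
      rw [hgc, h.apply_mod]
      split_ifs with hk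
      · rw [hk, cyc_self, ← hk, h.apply_mod]; omega
      · simp
    have hlip : ∀ u v, G.Adj u v → f u ≤ f v + 1 := by
      intro u v huv
      by_cases he : s(u, v) ∈ blockEdges c
      · obtain ⟨k, ⟨rfl, rfl⟩ | ⟨rfl, rfl⟩⟩ := adj_cases_of_mem_blockEdges he
        · have := cyc_succ_mod h.two_le (k := k) hgs
          rw [hfc, hfc]; omega
        · have := cyc_succ_mod h.two_le (k := k) hgs
          rw [hfc, hfc]; omega
      · have heq : g u = g v := hadj u v huv he
        simp only [hf]
        rw [heq]
        have h1 := dist_le_succ_of_adj hG huv s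
        have h2 := dist_le_succ_of_adj hG huv (c (g v))
        split_ifs <;> omega
    have := le_add_dist_of_lipschitz hG hlip x s
    simp only [hf, if_neg hxs, if_true, SimpleGraph.dist_self] at this
    omega

theorem IsBlock.dist_apply_right (h : IsBlock G n c) (hG : G.Connected) (x : V) (k : ℕ) :
    G.dist x (c k) = G.dist x (c (gate G c x)) + cyc n (gate G c x) (k % n) := by
  by_cases hx : gate G c x = gate G c (c k)
  · rw [hx, h.gate_apply hG, h.apply_mod, cyc_self, Nat.add_zero]
  · rw [h.dist_eq hG hx, h.gate_apply hG, h.apply_mod, SimpleGraph.dist_self, Nat.add_zero]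

theorem IsBlock.dist_le (h : IsBlock G n c) (hG : G.Connected) (x s : V) :
    G.dist x s ≤ G.dist x (c (gate G c x)) + cyc n (gate G c x) (gate G c s)
      + G.dist (c (gate G c s)) s := by
  by_cases hx : gate G c x = gate G c s
  · rw [hx, cyc_self]; exact hG.dist_triangle
  · exact (h.dist_eq hG hx).le

end Blocks

/-! ## Pieces avoiding a vertex set -/

/-- Positions `i < j < k` on a cycle of length `n` such that none of the three arcs between them is
longer than `n / 2`. -/
structure IsGeodesicTriple (n i j k : ℕ) : Prop where
  lt₁ : i < j
  lt₂ : j < k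
  lt₃ : k < n
  arc₁ : 2 * (j - i) ≤ n
  arc₂ : 2 * (k - j) ≤ n
  arc₃ : n ≤ 2 * (k - i)

/-- `S` meets at least one of any two threads attached to the same vertex. -/
def MeetsThreads {V : Type*} (G : SimpleGraph V) [G.LocallyFinite] (S : Finset V) : Prop :=
  ∀ v l₁ l₂, IsThreadAt G v l₁ → IsThreadAt G v l₂ → l₁ ≠ l₂ → ∃ s ∈ S, s ∈ l₁ ∨ s ∈ l₂

/-- Every cycle has a geodesic triple of vertices each of which is in `S` or branch-active. -/
def HasTriples {V : Type*} (G : SimpleGraph V) [G.LocallyFinite] (S : Finset V) : Prop :=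
  ∀ C : G.Subgraph, IsCycleSubgraph G C → ∃ n c, IsBlock G n c ∧ 3 ≤ n ∧
    C.verts = Set.range c ∧ C.edgeSet = blockEdges c ∧ ∃ i j k, IsGeodesicTriple n i j k ∧
      ∀ t, t = i ∨ t = j ∨ t = k → c t ∈ S ∨ IsBranchActive G C (c t)

section Pieces

variable {V : Type*} {G : SimpleGraph V} {n : ℕ} {c : ℕ → V}

theorem IsBlock.eq_of_mem_blockEdges (h : IsBlock G n c) {i : ℕ} {w : V}
    (he : s(c i, w) ∈ blockEdges c) : w = c (i + 1) ∨ w = c (i + (n - 1)) := by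
  have hn := h.two_le
  obtain ⟨k, ⟨h1, h2⟩ | ⟨h1, h2⟩⟩ := adj_cases_of_mem_blockEdges he
  · left
    have hm : i % n = k % n := h.mod_eq_of_eq h1
    rw [h2, ← h.apply_mod (k + 1), ← h.apply_mod (i + 1), Nat.add_mod k, ← hm, ← Nat.add_mod]
  · right
    have hm : i % n = (k + 1) % n := h.mod_eq_of_eq h1
    rw [h2, ← h.apply_mod (i + (n - 1)), Nat.add_mod i, hm, ← Nat.add_mod, h.apply_mod,
      show k + 1 + (n - 1) = k + n by omega, h.periodic]

theorem IsBlock.ncard_blockEdges_le (h : IsBlock G n c) (i : ℕ) :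
    {w | G.Adj (c i) w ∧ s(c i, w) ∈ blockEdges c}.ncard ≤ 2 := by
  refine (Set.ncard_le_ncard (t := {c (i + 1), c (i + (n - 1))}) ?_ (Set.toFinite _)).trans
    ((Set.ncard_insert_le _ _).trans (by rw [Set.ncard_singleton]))
  rintro w ⟨-, hw⟩
  exact h.eq_of_mem_blockEdges hw

theorem IsBlock.ncard_blockEdges_pos [Finite V] (h : IsBlock G n c) (i : ℕ) :
    0 < {w | G.Adj (c i) w ∧ s(c i, w) ∈ blockEdges c}.ncard := by
  rw [Set.ncard_pos (Set.toFinite _)]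
  exact ⟨c (i + 1), h.adj i, i, rfl⟩

theorem IsBlock.ncard_blockEdges_eq_one (h : IsBlock G 2 c) (i : ℕ) :
    {w | G.Adj (c i) w ∧ s(c i, w) ∈ blockEdges c}.ncard = 1 := by
  rw [Set.ncard_eq_one]
  refine ⟨c (i + 1), Set.eq_singleton_iff_unique_mem.2 ⟨⟨h.adj i, i, rfl⟩, ?_⟩⟩
  rintro w ⟨-, hw⟩
  rcases h.eq_of_mem_blockEdges hw with h | h <;> simpa using h

theorem exists_bridge_block_of_two (h : IsBlock G 2 c) {v w : V} (he : s(v, w) ∈ blockEdges c) :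
    ∃ a, c a = v ∧ c (a + 1) = w := by
  obtain ⟨k, ⟨h1, h2⟩ | ⟨h1, h2⟩⟩ := adj_cases_of_mem_blockEdges he
  · exact ⟨k, h1.symm, h2.symm⟩
  · exact ⟨k + 1, h1.symm, by rw [h2]; exact h.periodic k⟩

variable [Fintype V] [DecidableRel G.Adj]

theorem degree_eq_ncard_add_ncard (c : ℕ → V) (v : V) :
    G.degree v = {w | G.Adj v w ∧ s(v, w) ∈ blockEdges c}.ncard +
      {w | G.Adj v w ∧ s(v, w) ∉ blockEdges c}.ncard := by
  classical
  rw [← Set.ncard_union_eq _ (Set.toFinite _) (Set.toFinite _), ← card_neighborFinset_eq_degree,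
    ← Set.ncard_coe_finset]
  · congr 1
    ext w
    simp only [coe_neighborFinset, mem_neighborSet, Set.mem_union, Set.mem_ofPred_eq]
    tauto
  · rw [Set.disjoint_left]
    rintro w ⟨-, h⟩ ⟨-, h'⟩
    exact h' h

/-- `l` continues `v` to a path covering the piece of `v` at the block `c`. -/
structure IsTail (G : SimpleGraph V) [DecidableRel G.Adj] (c : ℕ → V) (v : V) (l : List V) :
    Prop where
  chain : (v :: l).IsChain G.Adj
  nodup : (v :: l).Nodup
  mem_iff : ∀ z, z ∈ v :: l ↔ (offBlock G c).Reachable v z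
  deg_two : ∀ u ∈ l.dropLast, G.degree u = 2
  deg_one : ∀ w ∈ l.getLast?, G.degree w = 1
  deg : G.degree v = {w | G.Adj v w ∧ s(v, w) ∈ blockEdges c}.ncard + if l = [] then 0 else 1

/-- The block vertex has at most two neighbours on the cycle and one along the tail, hence degree at
most 3; all other vertices of the piece have degree at most 2. -/
theorem IsTail.not_isBranchActive (h : IsBlock G n c) {C : G.Subgraph}
    (hV : C.verts = Set.range c) (hE : C.edgeSet = blockEdges c) {i : ℕ} {l : List V}
    (hl : IsTail G c (c i) l) : ¬ IsBranchActive G C (c i) := by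
  rintro ⟨-, w, hr, hw⟩
  rw [hE] at hr
  have hdeg : G.degree (c i) ≤ 3 := by
    rw [hl.deg]
    have := h.ncard_blockEdges_le i
    split_ifs <;> omega
  have hmem := (hl.mem_iff w).2 hr
  have hne : w ≠ c i → G.degree w ≤ 2 := by
    intro hne
    have hwl : w ∈ l := by simpa [hne] using hmem
    have hl0 : l ≠ [] := List.ne_nil_of_mem hwl
    rw [← List.dropLast_append_getLast hl0, List.mem_append, List.mem_singleton] at hwl
    rcases hwl with hwl | hwl
    · exact (hl.deg_two w hwl).le
    · have := hl.deg_one w (by rw [hwl, List.getLast?_eq_getLast_of_ne_nil hl0]; rfl)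
      omega
  rcases hw with ⟨hwC, hw⟩ | ⟨hwC, hw⟩
  · have : w ≠ c i := by rintro rfl; exact hwC (hV ▸ ⟨i, rfl⟩)
    have := hne this
    omega
  · by_cases hwi : w = c i
    · subst hwi; omega
    · have := hne hwi
      omega

/-- At a bridge the block contributes a single neighbour, so `c i` itself has degree 2, or 1 if the
tail is empty: with `c i` included, the piece has the degree pattern of a thread. -/
theorem IsTail.thread (h : IsBlock G 2 c) {i : ℕ} {l : List V} (hl : IsTail G c (c i) l) :
    (∀ u ∈ (c i :: l).dropLast, G.degree u = 2) ∧
      ∃ w ∈ (c i :: l).getLast?, G.degree w = 1 := by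
  have hd := hl.deg
  rw [h.ncard_blockEdges_eq_one] at hd
  rcases List.eq_nil_or_concat l with rfl | ⟨l', b, rfl⟩
  · simpa using hd
  · have h2 := hl.deg_two
    have h1 := hl.deg_one
    simp only [List.concat_eq_append] at h1 h2 hd ⊢
    rw [if_neg (by simp)] at hd
    rw [← List.cons_append, List.dropLast_concat]
    rw [List.dropLast_concat] at h2
    simp only [List.getLast?_append, List.getLast?_singleton, Option.some_or, Option.mem_def,
      Option.some.injEq, forall_eq', exists_eq_left'] at h1 ⊢
    refine ⟨?_, h1⟩
    intro u hu
    rcases List.mem_cons.1 hu with rfl | hu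
    · exact hd
    · exact h2 u hu

variable {S : Finset V}

/-- A piece that avoids `S` is a path. -/
theorem IsBlock.exists_isTail (hG : IsCactus G) (hT : MeetsThreads G S) (hC : HasTriples G S) :
    ∀ (n : ℕ) (c : ℕ → V) (i : ℕ), IsBlock G n c →
      (∀ s ∈ S, ¬ (offBlock G c).Reachable (c i) s) → ∃ l, IsTail G c (c i) l := by
  -- Induction on the number of vertices of the piece, over all blocks at once.
  suffices H : ∀ (N n : ℕ) (c : ℕ → V) (i : ℕ), IsBlock G n c →
      {z | (offBlock G c).Reachable (c i) z}.ncard < N →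
      (∀ s ∈ S, ¬ (offBlock G c).Reachable (c i) s) → ∃ l, IsTail G c (c i) l from
    fun n c i h hS => H _ n c i h (Nat.lt_succ_self _) hS
  intro N
  induction N with
  | zero => intro n c i _ hN; omega
  | succ N ih =>
  intro n c i h hN hS
  -- pieces at a further block through `c i`
  have sub : ∀ {m : ℕ} {d : ℕ → V} {a j : ℕ}, IsBlock G m d →
      Disjoint (blockEdges c) (blockEdges d) → c i = d a → j % m ≠ a % m →
      (∀ z, (offBlock G d).Reachable (d j) z → (offBlock G c).Reachable (c i) z) ∧
        ∃ l, IsTail G d (d j) l := by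
    intro m d a j hd hdis ha hj
    have hsub : ∀ z, (offBlock G d).Reachable (d j) z → (offBlock G c).Reachable (c i) z :=
      fun z hz => h.reachable_of_disjoint hd hdis ha hj hz
    refine ⟨hsub, ih m d j hd ?_ fun s hs hr => hS s hs (hsub s hr)⟩
    -- The smaller piece lies in the piece of `c i` but misses `c i`.
    refine lt_of_lt_of_le (Set.ncard_lt_ncard ?_ (Set.toFinite _)) (Nat.lt_succ_iff.1 hN)
    refine Set.ssubset_iff_exists.2 ⟨hsub, c i, Reachable.refl _, ?_⟩
    intro hr
    rw [ha] at hr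
    exact hj (hd.sep _ _ hr)
  have hdisj : ∀ {m : ℕ} {d : ℕ → V} {e : Sym2 V}, IsBlock G m d → e ∈ blockEdges d →
      e ∉ blockEdges c → Disjoint (blockEdges c) (blockEdges d) := by
    intro m d e hd he hec
    rw [Set.disjoint_left]
    intro f hf hf'
    rw [h.blockEdges_eq_of_mem hG hd hf hf'] at hec
    exact hec he
  have claim : ∀ w, G.Adj (c i) w → s(c i, w) ∉ blockEdges c →
      ∃ d a, IsBlock G 2 d ∧ d a = c i ∧ d (a + 1) = w ∧
        Disjoint (blockEdges c) (blockEdges d) := by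
    intro w hw hwc
    obtain ⟨m, d, hd, he⟩ := exists_block_of_adj hG hw
    rcases hd.two_le.lt_or_eq with hm | rfl
    · exfalso
      -- A cycle through `c i` is impossible: one of its triple vertices differs from `c i`, and its
      -- piece is free of `S`, hence by induction a tail. That vertex is then neither in `S` nor
      -- branch-active.
      obtain ⟨C, hCC, -, hE⟩ := hd.cycle hm
      obtain ⟨m', d', hd', -, hV, hE', p, q, r, ht, hact⟩ := hC C hCC
      rw [← hE, hE'] at he
      have hdis := hdisj hd' he hwc
      have ⟨a, ha⟩ : ∃ a, c i = d' a := by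
        obtain ⟨k, hk | hk⟩ := adj_cases_of_mem_blockEdges he
        · exact ⟨_, hk.1⟩
        · exact ⟨_, hk.1⟩
      have ⟨t, ht1, ht2⟩ : ∃ t, (t = p ∨ t = q ∨ t = r) ∧ t % m' ≠ a % m' := by
        have := ht.lt₁
        have := ht.lt₂
        have := ht.lt₃
        by_cases hp : p % m' = a % m'
        · refine ⟨q, by simp, ?_⟩
          rw [← hp, Nat.mod_eq_of_lt (by omega), Nat.mod_eq_of_lt (by omega)]
          omega
        · exact ⟨p, by simp, hp⟩
      obtain ⟨hsub, l, hl⟩ := sub hd' hdis ha ht2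
      rcases hact t ht1 with hs | hb
      · exact hS _ hs (hsub _ (Reachable.refl _))
      · exact hl.not_isBranchActive hd' hV hE' hb
    · obtain ⟨a, ha, ha'⟩ := exists_bridge_block_of_two hd he
      exact ⟨d, a, hd, ha, ha', hdisj hd he hwc⟩
  have hone : ∀ a : ℕ, (a + 1) % 2 ≠ a % 2 := by omega
  have hdeg := degree_eq_ncard_add_ncard (G := G) c (c i)
  have hpos := h.ncard_blockEdges_pos i
  set B := {w | G.Adj (c i) w ∧ s(c i, w) ∉ blockEdges c} with hB
  -- Two further bridges, together with a neighbour on the block, make the degree at least 3; by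
  -- induction the bridges then start two threads that `S` misses.
  have hsubs : B.Subsingleton := by
    intro w₁ h₁ w₂ h₂
    by_contra hne
    have h3 : 3 ≤ G.degree (c i) := by
      have : ({w₁, w₂} : Set V).ncard ≤ B.ncard :=
        Set.ncard_le_ncard (Set.insert_subset h₁ (Set.singleton_subset_iff.2 h₂)) (Set.toFinite _)
      rw [Set.ncard_pair hne] at this
      omega
    have thr : ∀ w, w ∈ B → ∃ l, IsThreadAt G (c i) (w :: l) ∧ ∀ s ∈ S, s ∉ w :: l := by
      intro w hw
      obtain ⟨d, a, hd, ha, rfl, hdis⟩ := claim w hw.1 hw.2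
      obtain ⟨hsub, l, hl⟩ := sub (j := a + 1) hd hdis ha.symm (hone a)
      obtain ⟨t1, t2⟩ := hl.thread hd
      exact ⟨l, ⟨h3, List.isChain_cons_cons.2 ⟨hw.1, hl.chain⟩, hl.nodup, t1, t2⟩,
        fun s hs hsl => hS s hs (hsub s ((hl.mem_iff s).1 hsl))⟩
    obtain ⟨l₁, t₁, f₁⟩ := thr w₁ h₁
    obtain ⟨l₂, t₂, f₂⟩ := thr w₂ h₂
    obtain ⟨s, hs, hs' | hs'⟩ := hT _ _ _ t₁ t₂ (by simp [hne])
    · exact f₁ s hs hs'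
    · exact f₂ s hs hs'
  rcases hsubs.eq_empty_or_singleton with hB0 | ⟨w, hBw⟩
  · refine ⟨[], by simp, by simp, fun z => ?_, by simp, by simp, by simp [hdeg, hB0]⟩
    simp only [List.mem_singleton]
    constructor
    · rintro rfl; exact Reachable.refl _
    · intro hz
      rw [reachable_iff_reflTransGen] at hz
      induction hz with
      | refl => rfl
      | tail _ hwx ih =>
        subst ih
        rw [deleteEdges_adj] at hwx
        have : _ ∈ B := hwx
        rw [hB0] at this
        exact this.elim
  · have hw : w ∈ B := by rw [hBw]; rfl
    obtain ⟨d, a, hd, ha, rfl, hdis⟩ := claim w hw.1 hw.2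
    obtain ⟨hsub, l, hl⟩ := sub (j := a + 1) hd hdis ha.symm (hone a)
    obtain ⟨t1, t2⟩ := hl.thread hd
    have hnot : ¬ (offBlock G d).Reachable (d (a + 1)) (c i) := by
      rw [← ha]
      intro hr
      exact hone a (hd.sep _ _ hr)
    refine ⟨d (a + 1) :: l, List.isChain_cons_cons.2 ⟨hw.1, hl.chain⟩,
      List.nodup_cons.2 ⟨fun hm => hnot ((hl.mem_iff _).1 hm), hl.nodup⟩, fun z => ?_, t1, ?_, ?_⟩
    · rw [List.mem_cons, hl.mem_iff]
      constructor
      · rintro (rfl | hz)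
        · exact Reachable.refl _
        · exact hsub z hz
      · intro hz
        rw [reachable_iff_reflTransGen] at hz
        induction hz with
        | refl => exact Or.inl rfl
        | @tail x z _ hxz ih =>
          rw [deleteEdges_adj] at hxz
          rcases ih with rfl | hx
          · have : z ∈ B := hxz
            rw [hBw] at this
            right
            rw [Set.mem_singleton_iff.1 this]
          · by_cases he : s(x, z) ∈ blockEdges d
            · rw [hd.blockEdges_eq a, Set.mem_singleton_iff, ha, Sym2.eq_iff] at he
              rcases he with ⟨-, rfl⟩ | ⟨-, rfl⟩
              · exact Or.inr (Reachable.refl _)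
              · exact Or.inl rfl
            · refine Or.inr (hx.trans (Adj.reachable ?_))
              rw [deleteEdges_adj]
              exact ⟨hxz.1, he⟩
    · obtain ⟨x, hx, hx1⟩ := t2
      intro y hy
      rw [Option.mem_def] at hx hy
      rw [hx] at hy
      cases hy
      exact hx1
    · rw [hdeg, hBw, Set.ncard_singleton, if_neg (by simp)]

/-- Each position of the geodesic triple of a cycle is the gate of some element of `S`. -/
theorem exists_gate_triple (hG : IsCactus G) (hT : MeetsThreads G S) (hC : HasTriples G S)
    {C : G.Subgraph} (hCC : IsCycleSubgraph G C) :
    ∃ n c, IsBlock G n c ∧ C.edgeSet = blockEdges c ∧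
      ∃ a ∈ S, ∃ b ∈ S, ∃ d ∈ S, IsGeodesicTriple n (gate G c a) (gate G c b) (gate G c d) := by
  obtain ⟨n, c, h, -, hV, hE, i, j, k, ht, hact⟩ := hC C hCC
  -- Otherwise the piece of `c t` avoids `S`, so it is a tail, and `c t` is neither in `S` nor
  -- branch-active.
  have key : ∀ t, (t = i ∨ t = j ∨ t = k) → t < n → ∃ s ∈ S, gate G c s = t := by
    intro t htt htn
    by_contra hno
    push Not at hno
    have hfree : ∀ s ∈ S, ¬ (offBlock G c).Reachable (c t) s := by
      intro s hs hr
      apply hno s hs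
      rw [h.gate_eq_of_reachable hG.1 hr, Nat.mod_eq_of_lt htn]
    obtain ⟨l, hl⟩ := IsBlock.exists_isTail hG hT hC n c t h hfree
    rcases hact t htt with hs | hb
    · exact hfree _ hs (Reachable.refl _)
    · exact hl.not_isBranchActive h hV hE hb
  have := ht.lt₁
  have := ht.lt₂
  have := ht.lt₃
  obtain ⟨x, hx, rfl⟩ := key i (by simp) (by omega)
  obtain ⟨y, hy, rfl⟩ := key j (by simp) (by omega)
  obtain ⟨z, hz, rfl⟩ := key k (by simp) (by omega)
  exact ⟨n, c, h, hE, x, hx, y, hy, z, hz, ht⟩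

end Pieces

/-! ## A geodesic triple resolves different positions -/

/-- A point between the vertices `a` and `b` of a geodesic triple with arcs `α, β, γ`, at distances
`x, y, z` from the vertices of the triple. -/
structure InArc (α β γ x y z : ℕ) : Prop where
  add_eq : x + y = α
  eq_min : z = min (β + y) (γ + x)

/-- If `x < x'`, then `A` is exact for the second point and `B` for the first, and adding the two
comparisons gives `x' + y ≤ x + y'`, which is absurd since both sums `x + y`, `x' + y'` are `α`. The
case `x' < x` is symmetric. -/
theorem InArc.eq_of_same {α β γ x z x' y' z' h h' p q r A B D : ℕ}
    (hα : 0 < α) (hγ : 0 < γ) (h₁ : α ≤ β + γ) (h₂ : β ≤ γ + α)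
    (i : InArc α β γ x y z) (i' : InArc α β γ x' y' z')
    (hA : A ≤ h + x + p) (hB : B ≤ h + y + q) (hA' : A ≤ h' + x' + p) (hB' : B ≤ h' + y' + q)
    (eA : x = 0 ∨ A = h + x + p) (eB : y = 0 ∨ B = h + y + q)
    (eD : z = 0 ∨ D = h + z + r) (eA' : x' = 0 ∨ A = h' + x' + p)
    (eB' : y' = 0 ∨ B = h' + y' + q) (eD' : z' = 0 ∨ D = h' + z' + r) : x = x' := by
  obtain ⟨i1, i2⟩ := i
  obtain ⟨i1', i2'⟩ := i'
  omega

/-- The points lie in arcs sharing the middle vertex. `D` is exact for the first and `A` for the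
second, which gives `z + x' ≤ x + z'`; if both far distances run through the shared vertex, then `y
= y' = 0`. The other route can only tie, when an arc is half the cycle, and then `B` decides. -/
theorem InArc.eq_of_next {α β γ x y z x' y' z' h h' p q r A B D : ℕ}
    (hα : 0 < α) (hβ : 0 < β) (hγ : 0 < γ) (h₁ : α ≤ β + γ) (h₂ : β ≤ γ + α)
    (i : InArc α β γ x y z) (i' : InArc β γ α y' z' x')
    (hA : A ≤ h + x + p) (hB : B ≤ h + y + q)
    (hB' : B ≤ h' + y' + q) (hD' : D ≤ h' + z' + r)
    (eB : y = 0 ∨ B = h + y + q)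
    (eD : z = 0 ∨ D = h + z + r) (eA' : x' = 0 ∨ A = h' + x' + p)
    (eB' : y' = 0 ∨ B = h' + y' + q)  : y = 0 ∧ y' = 0 := by
  obtain ⟨i1, i2⟩ := i
  obtain ⟨i1', i2'⟩ := i'
  have hz : 0 < z := by omega
  have hx' : 0 < x' := by omega
  have eD := eD.resolve_left hz.ne'
  have eA' := eA'.resolve_left hx'.ne'
  rcases eB with rfl | eB <;> rcases eB' with rfl | eB' <;> omega
theorem cyc_eq_zero {n i j : ℕ} (hi : i < n) (hj : j < n) : cyc n i j = 0 ↔ i = j := by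
  simp only [cyc]
  omega

theorem cyc_of_le {n i j : ℕ} (h : i ≤ j) : cyc n i j = min (j - i) (n - (j - i)) := by
  simp only [cyc]
  omega

theorem cyc_of_ge {n i j : ℕ} (h : j ≤ i) : cyc n i j = min (i - j) (n - (i - j)) := by
  rw [cyc_comm, cyc_of_le h]

/-- No arc exceeds half the cycle, so inside an arc the distances to its ends are measured along it.
The equation for `y` recovers the position; the third arc wraps around 0 and needs two forms. -/
theorem IsGeodesicTriple.inArc {n a b d y : ℕ} (t : IsGeodesicTriple n a b d) (hy : y < n) :
    (y = a + cyc n y a ∧ InArc (b - a) (d - b) (n - (d - a)) (cyc n y a) (cyc n y b) (cyc n y d)) ∨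
    (y = b + cyc n y b ∧ InArc (d - b) (n - (d - a)) (b - a) (cyc n y b) (cyc n y d) (cyc n y a)) ∨
    ((y = d + cyc n y d ∨ y + cyc n y a = a) ∧
      InArc (n - (d - a)) (b - a) (d - b) (cyc n y d) (cyc n y a) (cyc n y b)) := by
  obtain ⟨h1, h2, h3, h4, h5, h6⟩ := t
  by_cases c1 : y < a
  · rw [cyc_of_le (show y ≤ a by omega), cyc_of_le (show y ≤ b by omega),
      cyc_of_le (show y ≤ d by omega)]
    exact Or.inr (Or.inr ⟨Or.inr (by omega), by omega, by omega⟩)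
  by_cases c2 : y ≤ b
  · rw [cyc_of_ge (show a ≤ y by omega), cyc_of_le (show y ≤ b by omega),
      cyc_of_le (show y ≤ d by omega)]
    exact Or.inl ⟨by omega, by omega, by omega⟩
  by_cases c3 : y ≤ d
  · rw [cyc_of_ge (show a ≤ y by omega), cyc_of_ge (show b ≤ y by omega),
      cyc_of_le (show y ≤ d by omega)]
    exact Or.inr (Or.inl ⟨by omega, by omega, by omega⟩)
  · rw [cyc_of_ge (show a ≤ y by omega), cyc_of_ge (show b ≤ y by omega),
      cyc_of_ge (show d ≤ y by omega)]
    exact Or.inr (Or.inr ⟨Or.inl (by omega), by omega, by omega⟩)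

theorem IsGeodesicTriple.arcs {n a b d : ℕ} (t : IsGeodesicTriple n a b d) :
    0 < b - a ∧ 0 < d - b ∧ 0 < n - (d - a) ∧ b - a ≤ d - b + (n - (d - a)) ∧
      d - b ≤ n - (d - a) + (b - a) ∧ n - (d - a) ≤ b - a + (d - b) := by
  obtain ⟨h1, h2, h3, h4, h5, h6⟩ := t
  omega

theorem IsGeodesicTriple.lt_n {n a b d : ℕ} (t : IsGeodesicTriple n a b d) : a < n ∧ b < n :=
  ⟨t.lt₁.trans (t.lt₂.trans t.lt₃), t.lt₂.trans t.lt₃⟩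

/-- Two points hanging at heights `h, h'` over different positions `y, y'` of a cycle are at
different distances from some vertex of a geodesic triple. -/
theorem IsGeodesicTriple.resolves {n a b d : ℕ} (t : IsGeodesicTriple n a b d)
    {y y' h h' p q r A B D : ℕ} (hy : y < n) (hy' : y' < n)
    (hA : A ≤ h + cyc n y a + p) (hB : B ≤ h + cyc n y b + q) (hD : D ≤ h + cyc n y d + r)
    (hA' : A ≤ h' + cyc n y' a + p) (hB' : B ≤ h' + cyc n y' b + q)
    (hD' : D ≤ h' + cyc n y' d + r)
    (eA : y ≠ a → A = h + cyc n y a + p) (eB : y ≠ b → B = h + cyc n y b + q)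
    (eD : y ≠ d → D = h + cyc n y d + r) (eA' : y' ≠ a → A = h' + cyc n y' a + p)
    (eB' : y' ≠ b → B = h' + cyc n y' b + q) (eD' : y' ≠ d → D = h' + cyc n y' d + r) :
    y = y' := by
  have i := t.inArc hy
  have i' := t.inArc hy'
  obtain ⟨pα, pβ, pγ, l₁, l₂, l₃⟩ := t.arcs
  have zA := cyc_eq_zero hy t.lt_n.1
  have zB := cyc_eq_zero hy t.lt_n.2
  have zD := cyc_eq_zero hy t.lt₃
  have zA' := cyc_eq_zero hy' t.lt_n.1
  have zB' := cyc_eq_zero hy' t.lt_n.2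
  have zD' := cyc_eq_zero hy' t.lt₃
  rw [← or_iff_not_imp_left, ← zA] at eA
  rw [← or_iff_not_imp_left, ← zB] at eB
  rw [← or_iff_not_imp_left, ← zD] at eD
  rw [← or_iff_not_imp_left, ← zA'] at eA'
  rw [← or_iff_not_imp_left, ← zB'] at eB'
  rw [← or_iff_not_imp_left, ← zD'] at eD'
  -- Any two of the three arcs are cyclically adjacent, so each case is `eq_of_same` or `eq_of_next`
  -- after a rotation or an exchange of the two points.
  rcases i with ⟨e, i⟩ | ⟨e, i⟩ | ⟨e, i⟩ <;> rcases i' with ⟨e', i'⟩ | ⟨e', i'⟩ | ⟨e', i'⟩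
  · have := i.eq_of_same pα pγ l₁ l₂ i' hA hB hA' hB' eA eB eD eA' eB' eD'
    exact e.trans ((congrArg (a + ·) this).trans e'.symm)
  · have := i.eq_of_next pα pβ pγ l₁ l₂ i' hA hB hB' hD' eB eD eA' eB'
    rw [zB.1 this.1, zB'.1 this.2]
  · have := i'.eq_of_next pγ pα pβ l₃ l₁ i hD' hA' hA hB eA' eB' eD eA
    rw [zA.1 this.2, zA'.1 this.1]
  · have := i'.eq_of_next pα pβ pγ l₁ l₂ i hA' hB' hB hD eB' eD' eA eB
    rw [zB.1 this.2, zB'.1 this.1]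
  · have := i.eq_of_same pβ pα l₂ l₃ i' hB hD hB' hD' eB eD eA eB' eD' eA'
    exact e.trans ((congrArg (b + ·) this).trans e'.symm)
  · have := i.eq_of_next pβ pγ pα l₂ l₃ i' hB hD hD' hA' eD eA eB' eD'
    rw [zD.1 this.1, zD'.1 this.2]
  · have := i.eq_of_next pγ pα pβ l₃ l₁ i' hD hA hA' hB' eA eB eD' eA'
    rw [zA.1 this.1, zA'.1 this.2]
  · have := i'.eq_of_next pβ pγ pα l₂ l₃ i hB' hD' hD hA eD' eA' eB eD
    rw [zD.1 this.2, zD'.1 this.1]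
  · have := i.eq_of_same pγ pβ l₃ l₁ i' hD hA hD' hA' eD eA eB eD' eA' eB'
    have := i.add_eq
    have := i'.add_eq
    clear eA eB eD eA' eB' eD' hA hB hD hA' hB' hD'
    have := t.lt₁
    have := t.lt₂
    have := t.lt₃
    omega

/-! ## Pairs separated by a cycle -/

section Separated

variable {V : Type*} {G : SimpleGraph V}

/-- Subdividing every edge doubles positions, which makes room for midpoints of cycle edges at the
odd positions, so that `IsGeodesicTriple.resolves` applies to edges. -/
theorem IsGeodesicTriple.double {n a b d : ℕ} (t : IsGeodesicTriple n a b d) :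
    IsGeodesicTriple (2 * n) (2 * a) (2 * b) (2 * d) := by
  obtain ⟨h1, h2, h3, h4, h5, h6⟩ := t
  constructor <;> omega

theorem cyc_double (n i j : ℕ) : cyc (2 * n) (2 * i) (2 * j) = 2 * cyc n i j := by
  simp only [cyc]
  omega

theorem cyc_double_succ {n k g : ℕ} (hk : k < n) (hg : g < n) (hn : 2 ≤ n) :
    cyc (2 * n) (2 * k + 1) (2 * g) = 2 * min (cyc n k g) (cyc n ((k + 1) % n) g) + 1 := by
  rw [succ_mod_eq n k hn, Nat.mod_eq_of_lt hk]
  simp only [cyc]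
  split_ifs <;> omega

/-- Position and height of an edge with respect to a block. -/
theorem IsBlock.edge_position {n : ℕ} {c : ℕ → V} (hG : G.Connected) (h : IsBlock G n c)
    {u v : V} (huv : G.Adj u v) :
    ∃ y < 2 * n, ∃ b, (∀ s, 2 * min (G.dist u s) (G.dist v s) + 1 ≤
        b + cyc (2 * n) y (2 * gate G c s) + 2 * G.dist (c (gate G c s)) s) ∧
      (∀ s, y ≠ 2 * gate G c s → 2 * min (G.dist u s) (G.dist v s) + 1 =
        b + cyc (2 * n) y (2 * gate G c s) + 2 * G.dist (c (gate G c s)) s) ∧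
      ((∃ k, y = 2 * k + 1 ∧ s(u, v) = s(c k, c (k + 1))) ∨
        s(u, v) ∉ blockEdges c ∧ y = 2 * gate G c u ∧ y = 2 * gate G c v) := by
  -- The quantity `2 * min + 1` is the distance from the midpoint of `uv` to `s` in the subdivided
  -- graph. A block edge has height 0 at an odd position; any other edge hangs over the common gate
  -- of its ends.
  by_cases he : s(u, v) ∈ blockEdges c
  · obtain ⟨l, hl⟩ := he
    simp only at hl
    have hk := Nat.mod_lt l h.pos
    have hkl : s(u, v) = s(c (l % n), c (l % n + 1)) := by
      rw [← hl, ← h.apply_mod (l % n + 1), Nat.mod_add_mod, h.apply_mod, h.apply_mod]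
    generalize l % n = k at hk hkl
    have hd : ∀ j s, G.dist (c j) s =
        cyc n (j % n) (gate G c s) + G.dist (c (gate G c s)) s := by
      intro j s
      by_cases hj : gate G c (c j) = gate G c s
      · rw [← hj, h.gate_apply hG, cyc_self, h.apply_mod, Nat.zero_add]
      · rw [h.dist_eq hG hj, h.gate_apply hG, h.apply_mod, SimpleGraph.dist_self, Nat.zero_add]
    have hmin : ∀ s, min (G.dist u s) (G.dist v s) =
        min (G.dist (c k) s) (G.dist (c (k + 1)) s) := by
      intro s
      rcases Sym2.eq_iff.1 hkl with ⟨rfl, rfl⟩ | ⟨rfl, rfl⟩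
      · rfl
      · rw [min_comm]
    have heq : ∀ s, 2 * min (G.dist u s) (G.dist v s) + 1 =
        0 + cyc (2 * n) (2 * k + 1) (2 * gate G c s) + 2 * G.dist (c (gate G c s)) s := by
      intro s
      rw [hmin, cyc_double_succ hk (h.gate_lt hG s) h.two_le, hd k, hd (k + 1),
        Nat.mod_eq_of_lt hk]
      omega
    exact ⟨2 * k + 1, by omega, 0, fun s => (heq s).le, fun s _ => heq s, Or.inl ⟨k, rfl, hkl⟩⟩
  · have hg := h.gate_eq_of_adj hG huv he
    refine ⟨2 * gate G c u, by have := h.gate_lt hG u; omega,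
      2 * min (G.dist u (c (gate G c u))) (G.dist v (c (gate G c v))) + 1, fun s => ?_,
      fun s hs => ?_, Or.inr ⟨he, rfl, by rw [hg]⟩⟩
    · have h1 := h.dist_le hG u s
      have h2 := h.dist_le hG v s
      rw [cyc_double]
      rw [hg] at h1 ⊢
      omega
    · have h1 := h.dist_eq hG (x := u) (s := s) (by omega)
      have h2 := h.dist_eq hG (x := v) (s := s) (by omega)
      rw [cyc_double]
      rw [hg] at h1 ⊢
      omega

variable [Fintype V] [DecidableRel G.Adj] {S : Finset V}

theorem gate_eq_of_dist_eq (hG : IsCactus G) (hT : MeetsThreads G S) (hC : HasTriples G S)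
    {x x' : V} (hx : ∀ s ∈ S, G.dist x s = G.dist x' s) {C : G.Subgraph}
    (hCC : IsCycleSubgraph G C) :
    ∃ n c, IsBlock G n c ∧ C.edgeSet = blockEdges c ∧ gate G c x = gate G c x' := by
  obtain ⟨n, c, h, hE, a, ha, b, hb, d, hd, t⟩ := exists_gate_triple hG hT hC hCC
  refine ⟨n, c, h, hE, ?_⟩
  exact t.resolves (h.gate_lt hG.1 x) (h.gate_lt hG.1 x') (h.dist_le hG.1 x a)
    (h.dist_le hG.1 x b) (h.dist_le hG.1 x d) (hx a ha ▸ h.dist_le hG.1 x' a)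
    (hx b hb ▸ h.dist_le hG.1 x' b) (hx d hd ▸ h.dist_le hG.1 x' d) (h.dist_eq hG.1)
    (h.dist_eq hG.1) (h.dist_eq hG.1) (fun h' => (hx a ha).trans (h.dist_eq hG.1 h'))
    (fun h' => (hx b hb).trans (h.dist_eq hG.1 h'))
    (fun h' => (hx d hd).trans (h.dist_eq hG.1 h'))

/-- Equal positions have equal parity, and equal odd positions mean equal edges. Hence both edges
lie off the cycle, over one gate. -/
theorem gate_eq_of_edgeDist_eq (hG : IsCactus G) (hT : MeetsThreads G S) (hC : HasTriples G S)
    {u v u' v' : V} (huv : G.Adj u v) (huv' : G.Adj u' v') (hne : s(u, v) ≠ s(u', v'))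
    (hx : ∀ s ∈ S, min (G.dist u s) (G.dist v s) = min (G.dist u' s) (G.dist v' s))
    {C : G.Subgraph} (hCC : IsCycleSubgraph G C) :
    ∃ n c, IsBlock G n c ∧ C.edgeSet = blockEdges c ∧ s(u, v) ∉ blockEdges c ∧
      s(u', v') ∉ blockEdges c ∧ gate G c u = gate G c v ∧ gate G c u = gate G c u' ∧
      gate G c u = gate G c v' := by
  obtain ⟨n, c, h, hE, a, ha, b, hb, d, hd, t⟩ := exists_gate_triple hG hT hC hCC
  refine ⟨n, c, h, hE, ?_⟩
  obtain ⟨y, hy, p, hle, heq, hpos⟩ := h.edge_position hG.1 huv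
  obtain ⟨y', hy', p', hle', heq', hpos'⟩ := h.edge_position hG.1 huv'
  have hx' : ∀ s ∈ S, 2 * min (G.dist u s) (G.dist v s) + 1 =
      2 * min (G.dist u' s) (G.dist v' s) + 1 := fun s hs => by rw [hx s hs]
  have := t.double.resolves hy hy' (hle a) (hle b) (hle d) (hx' a ha ▸ hle' a)
    (hx' b hb ▸ hle' b) (hx' d hd ▸ hle' d) (heq a) (heq b) (heq d)
    (fun h' => (hx' a ha).trans (heq' a h')) (fun h' => (hx' b hb).trans (heq' b h'))
    (fun h' => (hx' d hd).trans (heq' d h'))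
  rcases hpos with ⟨k, hk, he⟩ | ⟨he, h1, h2⟩ <;>
    rcases hpos' with ⟨k', hk', he'⟩ | ⟨he', h1', h2'⟩
  · have : k = k' := by omega
    rw [he, he', this] at hne
    exact absurd rfl hne
  · omega
  · omega
  · exact ⟨he, he', by omega, by omega, by omega⟩

omit [Fintype V] [DecidableRel G.Adj] in
-- If `w, w'` were on a cycle where `x, x'` have the same gate, the routes from `x` to `w` and from
-- `w'` to `x'` would both pass that gate, and the edge `ww'` would be a detour.
theorem isBridge_of_gate_eq (hG : IsCactus G) {x x' : V}
    (hx : ∀ C : G.Subgraph, IsCycleSubgraph G C →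
      ∃ n c, IsBlock G n c ∧ C.edgeSet = blockEdges c ∧ gate G c x = gate G c x')
    {w w' : V} (hw : G.Adj w w') (hd : G.dist x w + 1 + G.dist w' x' = G.dist x x') :
    G.IsBridge s(w, w') := by
  rw [isBridge_iff_forall_cycle_notMem hw]
  intro z p hp he
  obtain ⟨n, c, h, hE, hg⟩ := hx _ ⟨z, p, hp, rfl⟩
  rw [← Walk.mem_edges_toSubgraph, hE] at he
  have key : ∀ i j, w = c i → w' = c j → False := by
    rintro i j rfl rfl
    have h1 := h.dist_apply_right hG.1 x i
    have h2 := h.dist_apply_right hG.1 x' j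
    have h3 := h.dist_le hG.1 x x'
    rw [hg, cyc_self] at h3
    rw [hg] at h1
    rw [SimpleGraph.dist_comm (u := x')] at h2
    rw [SimpleGraph.dist_comm (u := x')] at h2
    omega
  obtain ⟨k, hk | hk⟩ := adj_cases_of_mem_blockEdges he
  · exact key _ _ hk.1 hk.2
  · exact key _ _ hk.1 hk.2

end Separated

/-! ## Bridges -/

section Bridges

variable {V : Type*} {G : SimpleGraph V} {p m : V}

/-- A bridge is a block with `n = 2`, so each vertex has one of two gates. Its side is expressed
here by distances alone. -/
theorem dist_bridge (hG : G.Connected) (ha : G.Adj p m) (hb : G.IsBridge s(p, m)) :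
    (∀ z, G.dist z p = G.dist z m + 1 ∨ G.dist z m = G.dist z p + 1) ∧
    ∀ z z', G.dist z m = G.dist z p + 1 → G.dist z' p = G.dist z' m + 1 →
      G.dist z z' = G.dist z p + 1 + G.dist z' m := by
  obtain ⟨c, h, rfl, rfl⟩ := exists_block_of_isBridge ha hb
  have h0 := fun z => h.dist_apply_right hG z 0
  have h1 := fun z => h.dist_apply_right hG z 1
  have hlt := fun z => h.gate_lt hG z
  have e00 : cyc 2 0 0 = 0 := rfl
  have e01 : cyc 2 0 1 = 1 := rfl
  have e10 : cyc 2 1 0 = 1 := rfl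
  have e11 : cyc 2 1 1 = 0 := rfl
  have key : ∀ z, gate G c z = 0 ∧ G.dist z (c 1) = G.dist z (c 0) + 1 ∨
      gate G c z = 1 ∧ G.dist z (c 0) = G.dist z (c 1) + 1 := by
    intro z
    have h0 := h0 z
    have h1 := h1 z
    have hz : gate G c z = 0 ∨ gate G c z = 1 := by have := hlt z; omega
    rcases hz with hz | hz
    · left; rw [hz, Nat.mod_eq_of_lt (by norm_num), e01] at h1; exact ⟨hz, h1⟩
    · right; rw [hz, Nat.zero_mod, e10] at h0; exact ⟨hz, h0⟩
  refine ⟨fun z => ?_, fun z z' hz hz' => ?_⟩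
  · rcases key z with h | h
    · exact Or.inr h.2
    · exact Or.inl h.2
  · have g0 : gate G c z = 0 := by rcases key z with h | h <;> omega
    have g1 : gate G c z' = 1 := by rcases key z' with h | h <;> omega
    rw [h.dist_eq hG (x := z) (s := z') (by omega), g0, g1, e01,
      SimpleGraph.dist_comm (u := z')]

variable [Fintype V] [DecidableRel G.Adj] {S : Finset V}

/-- A branch at a bridge that avoids `S` is a path ending in a leaf. -/
theorem exists_ray (hG : IsCactus G) (hT : MeetsThreads G S) (hC : HasTriples G S)
    (ha : G.Adj p m) (hb : G.IsBridge s(p, m)) (hS : ∀ s ∈ S, G.dist s m ≠ G.dist s p + 1) :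
    ∃ l, (m :: p :: l).IsChain G.Adj ∧ (p :: l).Nodup ∧
      (∀ z, z ∈ p :: l ↔ G.dist z m = G.dist z p + 1) ∧
      (∀ u ∈ (p :: l).dropLast, G.degree u = 2) ∧
      ∃ w ∈ (p :: l).getLast?, G.degree w = 1 := by
  have hd := dist_bridge hG.1 ha hb
  obtain ⟨c, h, hp, hm⟩ := exists_block_of_isBridge ha hb
  have key : ∀ z, (offBlock G c).Reachable (c 0) z ↔ G.dist z m = G.dist z p + 1 := by
    intro z
    have h0 := h.dist_apply_right hG.1 z 0
    have h1 := h.dist_apply_right hG.1 z 1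
    rw [hp] at h0
    rw [hm] at h1
    have hlt := h.gate_lt hG.1 z
    constructor
    · intro hr
      have hz := h.gate_eq_of_reachable hG.1 hr
      rw [hz, h.apply_mod, hp] at h1
      exact h1
    · intro hz
      apply h.reachable_of_gate_eq hG.1
      by_contra hne
      have hz1 : gate G c z = 1 := by omega
      rw [hz1, show cyc 2 1 (0 % 2) = 1 from rfl, hm] at h0
      omega
  obtain ⟨l, hl⟩ := IsBlock.exists_isTail hG hT hC 2 c 0 h
    fun s hs hr => hS s hs ((key s).1 hr)
  obtain ⟨t1, t2⟩ := hl.thread h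
  have hch := hl.chain
  have hnd := hl.nodup
  have hmem := hl.mem_iff
  simp only [key] at hmem
  rw [hp] at t1 t2 hch hnd hmem
  exact ⟨l, List.isChain_cons_cons.2 ⟨ha.symm, hch⟩, hnd, hmem, t1, t2⟩

/-! ## Recognizing paths -/

theorem card_le_degree {v : V} {s : Finset V} (hs : ∀ w ∈ s, G.Adj v w) : s.card ≤ G.degree v := by
  rw [← card_neighborFinset_eq_degree]
  exact Finset.card_le_card fun w hw => by rw [mem_neighborFinset]; exact hs w hw

/-- A chord would exceed the degree bound at its earlier end, which already has its list neighbours;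
the bound 1 at the head covers a chord starting there. -/
theorem nonempty_iso_pathGraph {L : List V} (hch : L.IsChain G.Adj) (hnd : L.Nodup)
    (hmem : ∀ z, z ∈ L) (hdeg : ∀ z, G.degree z ≤ 2) (hhead : ∀ z ∈ L.head?, G.degree z ≤ 1) :
    Nonempty (G ≃g pathGraph L.length) := by
  classical
  have hsucc : ∀ i (hi : i + 1 < L.length), G.Adj L[i] L[i + 1] :=
    fun i hi => List.isChain_iff_getElem.1 hch i hi
  have hinj : ∀ i j (hi : i < L.length) (hj : j < L.length), i ≠ j → L[i] ≠ L[j] :=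
    fun i j hi hj hij h => hij ((hnd.getElem_inj_iff).1 h)
  have hfar : ∀ i j (hi : i < L.length) (hj : j < L.length), i + 1 < j → ¬ G.Adj L[i] L[j] := by
    intro i j hi hj hij hadj
    rcases Nat.eq_zero_or_pos i with rfl | hi0
    · have h1 := hhead L[0] (by rw [List.head?_eq_getElem?, List.getElem?_eq_getElem hi]; rfl)
      have h2 : ({L[1], L[j]} : Finset V).card ≤ G.degree L[0] := by
        refine card_le_degree fun w hw => ?_
        rcases Finset.mem_insert.1 hw with rfl | hw
        · exact hsucc 0 (by omega)
        · rw [Finset.mem_singleton.1 hw]; exact hadj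
      rw [Finset.card_pair (hinj _ _ _ _ (by omega))] at h2
      omega
    · have h1 := hdeg L[i]
      have h2 : ({L[i - 1], L[i + 1], L[j]} : Finset V).card ≤ G.degree L[i] := by
        refine card_le_degree fun w hw => ?_
        rcases Finset.mem_insert.1 hw with rfl | hw
        · have := hsucc (i - 1) (by omega)
          simp only [show i - 1 + 1 = i by omega] at this
          exact this.symm
        rcases Finset.mem_insert.1 hw with rfl | hw
        · exact hsucc i (by omega)
        · rw [Finset.mem_singleton.1 hw]; exact hadj
      rw [Finset.card_eq_three.2 ⟨_, _, _, hinj _ _ _ _ (by omega), hinj _ _ _ _ (by omega),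
        hinj _ _ _ _ (by omega), rfl⟩] at h2
      omega
  refine ⟨RelIso.symm ⟨hnd.getEquivOfForallMemList L hmem, ?_⟩⟩
  intro i j
  rw [pathGraph_adj]
  simp only [List.Nodup.getEquivOfForallMemList_apply, List.get_eq_getElem]
  constructor
  · intro h
    by_contra hne
    rcases lt_trichotomy i.1 j.1 with hij | hij | hij
    · exact hfar i j i.2 j.2 (by omega) h
    · simp only [hij] at h
      exact h.ne rfl
    · exact hfar j i j.2 i.2 (by omega) h.symm
  · rintro (h | h)
    · have := hsucc i (by rw [h]; exact j.2)
      simpa only [h] using this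
    · have := hsucc j (by rw [h]; exact i.2)
      simpa only [h] using this.symm

/-- Two rays leaving `m` that cover the graph make it a path. -/
theorem exists_iso_pathGraph_of_rays {R T : List V} (hR0 : R ≠ [])
    (hR : (m :: R).IsChain G.Adj) (hT : (m :: T).IsChain G.Adj) (hRn : R.Nodup)
    (hTn : (m :: T).Nodup) (hdis : ∀ z, z ∈ R ↔ z ∉ m :: T)
    (h2 : ∀ z, G.degree z ≤ 2) (h1 : ∀ z ∈ R.getLast?, G.degree z ≤ 1) :
    ∃ n, 2 ≤ n ∧ Nonempty (G ≃g pathGraph n) := by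
  refine ⟨(R.reverse ++ m :: T).length, ?_, nonempty_iso_pathGraph ?_ ?_ ?_ h2 ?_⟩
  · have := List.length_pos_of_ne_nil hR0
    simp
    omega
  · have h : (R.reverse ++ [m]).IsChain G.Adj := by
      rw [← List.reverse_cons, List.isChain_reverse]
      exact hR.imp fun _ _ h => h.symm
    rw [List.isChain_append] at h ⊢
    refine ⟨h.1, hT, fun x hx y hy => h.2.2 x hx y ?_⟩
    simpa using hy
  · rw [List.nodup_append]
    refine ⟨List.nodup_reverse.2 hRn, hTn, ?_⟩
    rintro a ha b hb rfl
    exact (hdis a).1 (List.mem_reverse.1 ha) hb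
  · intro z
    rw [List.mem_append, List.mem_reverse, hdis]
    exact (em _).symm
  · intro z hz
    apply h1
    rw [List.head?_append_of_ne_nil _ (by simpa using hR0)] at hz
    simpa using hz

end Bridges

/-! ## Metric generators -/

section Generators

theorem exists_adj_dist_eq_add_one {V : Type*} {G : SimpleGraph V} (hG : G.Connected) {z m : V}
    (hz : z ≠ m) : ∃ w, G.Adj m w ∧ G.dist z m = G.dist z w + 1 := by
  obtain ⟨W, hW⟩ := hG.exists_walk_length_eq_dist m z
  cases W with
  | nil => exact absurd rfl hz
  | @cons _ w _ h p =>
    refine ⟨w, h, ?_⟩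
    have h1 := dist_le p
    have h2 := dist_le_succ_of_adj hG h z
    rw [Walk.length_cons] at hW
    rw [SimpleGraph.dist_comm, SimpleGraph.dist_comm (u := z)]
    omega

/-- Passing from `x'` to `u'` gains at most 1. If `p ≠ x`, then `u` is one step nearer to `p` than
`x` is, which makes up for it; if `p = x`, the length at least 2 of the geodesic does. -/
theorem min_dist_lt_of_off_centre {V : Type*} {G : SimpleGraph V} (hG : G.Connected) {x u x' u' p s : V} (ha : G.Adj x u)
    (ha' : G.Adj x' u') (hb : G.IsBridge s(x, u)) (hk : 2 ≤ G.dist x x')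
    (hx : G.dist x x' = G.dist u x' + 1) (hp : G.dist x p + G.dist x' p = G.dist x x')
    (h1 : 2 * G.dist x p < G.dist x x') (h2 : G.dist x' s = G.dist x' p + G.dist p s) :
    min (G.dist x s) (G.dist u s) < min (G.dist x' s) (G.dist u' s) := by
  have hd := dist_bridge hG ha hb
  have e1 := dist_le_succ_of_adj hG ha' s
  have t1 := hG.dist_triangle (u := x) (v := p) (w := s)
  have t2 := hG.dist_triangle (u := u) (v := p) (w := s)
  rcases hd.1 p with h | h
  · rw [SimpleGraph.dist_comm, SimpleGraph.dist_comm (u := p)] at h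
    omega
  · have h3 := hd.2 p x' h (by
      rw [SimpleGraph.dist_comm, SimpleGraph.dist_comm (u := x') (v := u)]; exact hx)
    rw [SimpleGraph.dist_comm (u := p) (v := x'), SimpleGraph.dist_comm (u := p) (v := x),
      SimpleGraph.dist_comm (u := x') (v := u)] at h3
    omega

variable {V : Type*} {G : SimpleGraph V} [Fintype V] [DecidableRel G.Adj] {S : Finset V}

theorem degree_le_two_of_ray {R : List V} (h2 : ∀ u ∈ R.dropLast, G.degree u = 2)
    (h1 : ∃ w ∈ R.getLast?, G.degree w = 1) {z : V} (hz : z ∈ R) : G.degree z ≤ 2 := by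
  have hR : R ≠ [] := List.ne_nil_of_mem hz
  obtain ⟨w, hw, hw1⟩ := h1
  rw [List.getLast?_eq_getLast_of_ne_nil hR, Option.mem_def, Option.some.injEq] at hw
  rw [← List.dropLast_append_getLast hR, List.mem_append, List.mem_singleton] at hz
  rcases hz with hz | hz
  · exact (h2 z hz).le
  · rw [hz, hw, hw1]; norm_num

theorem degree_le_one_of_ray {R : List V} (h1 : ∃ w ∈ R.getLast?, G.degree w = 1) :
    ∀ z ∈ R.getLast?, G.degree z ≤ 1 := by
  obtain ⟨w, hw, hw1⟩ := h1
  intro z hz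
  rw [Option.mem_def] at hw hz
  rw [hw] at hz
  cases hz
  exact hw1.le

/-- The two branches at a bridge do not both avoid `S`. -/
theorem false_of_free_bridge (hG : IsCactus G) (hT : MeetsThreads G S) (hC : HasTriples G S)
    (hpath : ∀ n : ℕ, 2 ≤ n → IsEmpty (G ≃g pathGraph n)) {p q : V} (ha : G.Adj p q)
    (hb : G.IsBridge s(p, q)) (hp : ∀ s ∈ S, G.dist s q ≠ G.dist s p + 1)
    (hq : ∀ s ∈ S, G.dist s p ≠ G.dist s q + 1) : False := by
  obtain ⟨l, hl1, hl2, hl3, hl4, hl5⟩ := exists_ray hG hT hC ha hb hp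
  obtain ⟨l', hl1', hl2', hl3', hl4', hl5'⟩ :=
    exists_ray hG hT hC ha.symm (by rwa [Sym2.eq_swap]) hq
  have hd := (dist_bridge hG.1 ha hb).1
  have hcov : ∀ z, z ∈ p :: l ↔ z ∉ q :: l' := by
    intro z
    rw [hl3, hl3']
    have := hd z
    omega
  obtain ⟨n, hn, ⟨f⟩⟩ := exists_iso_pathGraph_of_rays (by simp) hl1
    (List.isChain_cons_cons.1 hl1').2 hl2 hl2' hcov (fun z => by
      by_cases hz : z ∈ p :: l
      · exact degree_le_two_of_ray hl4 hl5 hz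
      · exact degree_le_two_of_ray hl4' hl5' (not_not.1 fun h => hz ((hcov z).2 h)))
    (degree_le_one_of_ray hl5)
  exact (hpath n hn).false f

/-- Two branches at bridges of the same vertex do not both avoid `S`. -/
theorem false_of_free_bridges (hG : IsCactus G) (hT : MeetsThreads G S) (hC : HasTriples G S)
    (hpath : ∀ n : ℕ, 2 ≤ n → IsEmpty (G ≃g pathGraph n)) {p m q : V} (hpq : p ≠ q)
    (ha : G.Adj p m) (hb : G.IsBridge s(p, m)) (ha' : G.Adj q m) (hb' : G.IsBridge s(q, m))
    (hp : ∀ s ∈ S, G.dist s m ≠ G.dist s p + 1)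
    (hq : ∀ s ∈ S, G.dist s m ≠ G.dist s q + 1) : False := by
  classical
  obtain ⟨l, hl1, hl2, hl3, hl4, hl5⟩ := exists_ray hG hT hC ha hb hp
  obtain ⟨l', hl1', hl2', hl3', hl4', hl5'⟩ := exists_ray hG hT hC ha' hb' hq
  -- In degree at least 3 the rays are two threads missed by `S`; otherwise `p` and `q` are the only
  -- neighbours of `m`, and the rays with `m` make up all of `G`, a path.
  rcases Nat.lt_or_ge (G.degree m) 3 with hm | hm
  · have hd := dist_bridge hG.1 ha hb
    have hd' := dist_bridge hG.1 ha' hb'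
    have hnb : ∀ w, G.Adj m w → w = p ∨ w = q := by
      intro w hw
      by_contra! hne
      have h3 : ({w, p, q} : Finset V).card ≤ G.degree m := by
        refine card_le_degree fun x hx => ?_
        simp only [Finset.mem_insert, Finset.mem_singleton] at hx
        rcases hx with rfl | rfl | rfl
        · exact hw
        · exact ha.symm
        · exact ha'.symm
      rw [Finset.card_eq_three.2 ⟨_, _, _, hne.1, hne.2, hpq, rfl⟩] at h3
      omega
    have hcov : ∀ z, z = m ∨ z ∈ p :: l ∨ z ∈ q :: l' := by
      intro z
      rcases eq_or_ne z m with rfl | hz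
      · exact Or.inl rfl
      · right
        obtain ⟨w, hw, hwz⟩ := exists_adj_dist_eq_add_one hG.1 hz
        rw [hl3, hl3']
        rcases hnb w hw with rfl | rfl
        · exact Or.inl hwz
        · exact Or.inr hwz
    have hmm : ∀ x, G.dist m m ≠ G.dist m x + 1 := by
      intro x; rw [SimpleGraph.dist_self]; omega
    have hdis : ∀ z, z ∈ p :: l → z ∈ q :: l' → False := by
      intro z hz hz'
      have h1 := (hl3 z).1 hz
      have h2 := (hl3' z).1 hz'
      have hqp : G.dist q p = G.dist q m + 1 := by
        rcases hd.1 q with h | h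
        · exact h
        · rw [dist_eq_one_iff_adj.2 ha'] at h
          have : G.dist q p = 0 := by omega
          exact absurd (hG.1.dist_eq_zero_iff.1 this).symm hpq
      have h3 := hd.2 z q h1 hqp
      omega
    obtain ⟨n, hn, ⟨f⟩⟩ := exists_iso_pathGraph_of_rays (by simp) hl1 hl1' hl2
      (List.nodup_cons.2 ⟨fun h => hmm q ((hl3' m).1 h), hl2'⟩)
      (fun z => by
        rw [List.mem_cons (a := z) (b := m)]
        constructor
        · rintro hz (rfl | hz')
          · exact hmm p ((hl3 _).1 hz)
          · exact hdis z hz hz'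
        · intro h
          rcases hcov z with h' | h' | h'
          · exact absurd (Or.inl h') h
          · exact h'
          · exact absurd (Or.inr h') h)
      (fun z => by
        rcases hcov z with rfl | hz | hz
        · omega
        · exact degree_le_two_of_ray hl4 hl5 hz
        · exact degree_le_two_of_ray hl4' hl5' hz)
      (degree_le_one_of_ray hl5)
    exact (hpath n hn).false f
  · obtain ⟨s, hs, h | h⟩ := hT m (p :: l) (q :: l') ⟨hm, hl1, hl2, hl4, hl5⟩
      ⟨hm, hl1', hl2', hl4', hl5'⟩ (by simp [hpq])
    · exact hp s hs ((hl3 s).1 h)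
    · exact hq s hs ((hl3' s).1 h)

/-- If a geodesic from `x` to `x'` consists of bridges, some `s ∈ S` is attached to it off its
centre. -/
theorem exists_off_centre (hG : IsCactus G) (hT : MeetsThreads G S) (hC : HasTriples G S)
    (hpath : ∀ n : ℕ, 2 ≤ n → IsEmpty (G ≃g pathGraph n)) {x x' : V} (hne : x ≠ x')
    (hbr : ∀ w w', G.Adj w w' → G.dist x w + 1 + G.dist w' x' = G.dist x x' →
      G.IsBridge s(w, w')) :
    ∃ s ∈ S, ∃ p, G.dist x p + G.dist x' p = G.dist x x' ∧
      (2 * G.dist x p < G.dist x x' ∧ G.dist x' s = G.dist x' p + G.dist p s ∨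
        2 * G.dist x' p < G.dist x x' ∧ G.dist x s = G.dist x p + G.dist p s) := by
  by_contra! hno
  obtain ⟨W, hW⟩ := hG.1.exists_walk_length_eq_dist x x'
  have hpos := hG.1.pos_dist_of_ne hne
  have hget : ∀ i ≤ G.dist x x', G.dist x (W.getVert i) = i ∧
      G.dist x' (W.getVert i) = G.dist x x' - i := by
    intro i hi
    have h1 : G.dist x (W.getVert i) ≤ i :=
      (dist_le (W.take i)).trans (by rw [Walk.take_length]; omega)
    have h2 : G.dist (W.getVert i) x' ≤ G.dist x x' - i :=
      (dist_le (W.drop i)).trans (by rw [Walk.drop_length]; omega)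
    have h3 := hG.1.dist_triangle (u := x) (v := W.getVert i) (w := x')
    rw [SimpleGraph.dist_comm (u := x')]
    omega
  have hstep : ∀ i, i + 1 ≤ G.dist x x' → G.Adj (W.getVert i) (W.getVert (i + 1)) ∧
      G.IsBridge s(W.getVert i, W.getVert (i + 1)) := by
    intro i hi
    have hadj := W.adj_getVert_succ (i := i) (by omega)
    refine ⟨hadj, hbr _ _ hadj ?_⟩
    have h1 := hget i (by omega)
    have h2 := hget (i + 1) hi
    rw [SimpleGraph.dist_comm (v := x')]
    omega
  -- branches before the centre avoid `S`
  have hleft : ∀ i, 2 * i < G.dist x x' → ∀ s ∈ S,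
      G.dist s (W.getVert (i + 1)) ≠ G.dist s (W.getVert i) + 1 := by
    intro i hi s hs hd
    have h1 := hget i (by omega)
    have h2 := hget (i + 1) (by omega)
    have h3 := (dist_bridge hG.1 (hstep i (by omega)).1 (hstep i (by omega)).2).2 s x' hd
      (by omega)
    refine (hno s hs (W.getVert i) (by omega)).1 (by omega) ?_
    rw [SimpleGraph.dist_comm (u := x') (v := s), SimpleGraph.dist_comm (v := s)]
    omega
  have hright : ∀ i, i + 1 ≤ G.dist x x' → G.dist x x' < 2 * (i + 1) → ∀ s ∈ S,
      G.dist s (W.getVert i) ≠ G.dist s (W.getVert (i + 1)) + 1 := by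
    intro i hi hi' s hs hd
    have h1 := hget i (by omega)
    have h2 := hget (i + 1) (by omega)
    have h3 := (dist_bridge hG.1 (hstep i (by omega)).1.symm
      (by rw [Sym2.eq_swap]; exact (hstep i (by omega)).2)).2 s x hd (by omega)
    refine (hno s hs (W.getVert (i + 1)) (by omega)).2 (by omega) ?_
    rw [SimpleGraph.dist_comm (u := x) (v := s), SimpleGraph.dist_comm (v := s)]
    omega
  -- Even length has a central vertex with a bridge on either side; odd length has a central bridge.
  rcases Nat.even_or_odd' (G.dist x x') with ⟨k, hk | hk⟩
  · obtain ⟨j, rfl⟩ : ∃ j, k = j + 1 := ⟨k - 1, by omega⟩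
    have s1 := hstep j (by omega)
    have s2 := hstep (j + 1) (by omega)
    refine false_of_free_bridges hG hT hC hpath (p := W.getVert j) (m := W.getVert (j + 1))
      (q := W.getVert (j + 1 + 1)) ?_ s1.1 s1.2 s2.1.symm (by rw [Sym2.eq_swap]; exact s2.2)
      (hleft j (by omega)) (hright (j + 1) (by omega) (by omega))
    intro h
    have h1 := hget j (by omega)
    have h2 := hget (j + 1 + 1) (by omega)
    rw [h] at h1
    omega
  · have s1 := hstep k (by omega)
    exact false_of_free_bridge hG hT hC hpath s1.1 s1.2 (hleft k (by omega))
      (hright k (by omega) (by omega))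

theorem isMetricGenerator_of_hasTriples (hG : IsCactus G) (hT : MeetsThreads G S)
    (hC : HasTriples G S) (hpath : ∀ n : ℕ, 2 ≤ n → IsEmpty (G ≃g pathGraph n)) :
    IsMetricGenerator G S := by
  intro x x' hne
  by_contra! hx
  have hbr := fun w w' hw hd => isBridge_of_gate_eq hG (x := x) (x' := x') (w := w) (w' := w')
    (fun C hCC => gate_eq_of_dist_eq hG hT hC hx hCC) hw hd
  obtain ⟨s, hs, p, hp, ⟨h1, h2⟩ | ⟨h1, h2⟩⟩ := exists_off_centre hG hT hC hpath hne hbr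
  · have := hG.1.dist_triangle (u := x) (v := p) (w := s)
    have := hx s hs
    omega
  · have := hG.1.dist_triangle (u := x') (v := p) (w := s)
    have := hx s hs
    omega

theorem isEdgeMetricGenerator_of_hasTriples (hG : IsCactus G) (hT : MeetsThreads G S)
    (hC : HasTriples G S) (hpath : ∀ n : ℕ, 2 ≤ n → IsEmpty (G ≃g pathGraph n)) :
    IsEdgeMetricGenerator G S := by
  -- Here `x, x'` are endpoints of the two edges at maximal distance; since the edges turn out to be
  -- bridges, `u` and `u'` are then strictly nearer to the opposite end.
  have main : ∀ x u x' u', G.Adj x u → G.Adj x' u' → s(x, u) ≠ s(x', u') →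
      G.dist u x' ≤ G.dist x x' → G.dist x u' ≤ G.dist x x' →
      ¬ ∀ s ∈ S, min (G.dist x s) (G.dist u s) = min (G.dist x' s) (G.dist u' s) := by
    intro x u x' u' ha ha' hne hu hu' hS
    have hgate := fun C hCC => gate_eq_of_edgeDist_eq hG hT hC ha ha' hne hS (C := C) hCC
    have hb : G.IsBridge s(x, u) := by
      rw [isBridge_iff_forall_cycle_notMem ha]
      intro z p hp he
      obtain ⟨n, c, h, hE, h1, -⟩ := hgate _ ⟨z, p, hp, rfl⟩
      rw [← Walk.mem_edges_toSubgraph, hE] at he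
      exact h1 he
    have hb' : G.IsBridge s(x', u') := by
      rw [isBridge_iff_forall_cycle_notMem ha']
      intro z p hp he
      obtain ⟨n, c, h, hE, -, h1, -⟩ := hgate _ ⟨z, p, hp, rfl⟩
      rw [← Walk.mem_edges_toSubgraph, hE] at he
      exact h1 he
    have hd := (dist_bridge hG.1 ha hb).1 x'
    have hd' := (dist_bridge hG.1 ha' hb').1 x
    rw [SimpleGraph.dist_comm, SimpleGraph.dist_comm (u := x') (v := u)] at hd
    -- At distance at most 1, `u = x'` and `u' = x`, so the edges would coincide.
    have hk : 2 ≤ G.dist x x' := by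
      by_contra hlt
      have h1 : u = x' := hG.1.dist_eq_zero_iff.1 (by omega)
      have h2 : x = u' := hG.1.dist_eq_zero_iff.1 (by omega)
      exact hne (by rw [h1, h2, Sym2.eq_swap])
    have hxx : x ≠ x' := by
      rintro rfl
      rw [SimpleGraph.dist_self] at hk
      omega
    have hbr := fun w w' hw hd => isBridge_of_gate_eq hG (x := x) (x' := x') (w := w) (w' := w')
      (fun C hCC => by
        obtain ⟨n, c, h, hE, -, -, -, h1, -⟩ := hgate C hCC
        exact ⟨n, c, h, hE, h1⟩) hw hd
    obtain ⟨s, hs, p, hp, ⟨h1, h2⟩ | ⟨h1, h2⟩⟩ := exists_off_centre hG hT hC hpath hxx hbr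
    · have := min_dist_lt_of_off_centre hG.1 ha ha' hb hk (by omega) hp h1 h2
      exact this.ne (hS s hs)
    · have hc := SimpleGraph.dist_comm (G := G) (u := x) (v := x')
      have hc' := SimpleGraph.dist_comm (G := G) (u := x) (v := u')
      have := min_dist_lt_of_off_centre hG.1 ha' ha hb' (by omega) (by omega) (by omega)
        (by omega) h2
      exact this.ne (hS s hs).symm
  intro e he f hf hef
  induction e with
  | _ u v =>
  induction f with
  | _ u' v' =>
  rw [mem_edgeSet] at he hf
  by_contra! hS
  simp only [edgeDist, Sym2.lift_mk] at hS
  have swap : ∀ a b : V, s(a, b) = s(b, a) := fun a b => Sym2.eq_swap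
  have c1 := SimpleGraph.dist_comm (G := G) (u := u) (v := u')
  -- The cases select the farthest of the four pairs of endpoints.
  rcases le_total (G.dist v u') (G.dist u u') with h1 | h1 <;>
    rcases le_total (G.dist v v') (G.dist u v') with h2 | h2
  · rcases le_total (G.dist u v') (G.dist u u') with h3 | h3
    · exact main u v u' v' he hf hef h1 h3 hS
    · exact main u v v' u' he hf.symm (by rwa [swap v']) h2 h3
        fun s hs => by rw [hS s hs, min_comm]
  · rcases le_total (G.dist v v') (G.dist u u') with h3 | h3
    · exact main u v u' v' he hf hef h1 (by omega) hS
    · exact main v u v' u' he.symm hf.symm (by rwa [swap v', swap v]) h2 (by omega)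
        fun s hs => by rw [min_comm, hS s hs, min_comm]
  · rcases le_total (G.dist u v') (G.dist v u') with h3 | h3
    · exact main v u u' v' he.symm hf (by rwa [swap v]) h1 (by omega)
        fun s hs => by rw [min_comm, hS s hs]
    · exact main u v v' u' he hf.symm (by rwa [swap v']) h2 (by omega)
        fun s hs => by rw [hS s hs, min_comm]
  · rcases le_total (G.dist v v') (G.dist v u') with h3 | h3
    · exact main v u u' v' he.symm hf (by rwa [swap v]) h1 h3
        fun s hs => by rw [min_comm, hS s hs]
    · exact main v u v' u' he.symm hf.symm (by rwa [swap v', swap v]) h2 h3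
        fun s hs => by rw [min_comm, hS s hs, min_comm]

end Generators

/-! ## Construction of a small generator -/

section Construction

/-- If `p, q` are at most half the cycle apart, the third point lies about half a turn after `p`,
the maximum keeping it beyond an antipodal `q`, and is reduced by `n` when it passes the end.
Otherwise it is the midpoint of the long arc. -/
theorem exists_isGeodesicTriple {n p q : ℕ} (hn : 3 ≤ n) (hpq : p < q) (hq : q < n) :
    ∃ i j k, IsGeodesicTriple n i j k ∧ (p = i ∨ p = j ∨ p = k) ∧ (q = i ∨ q = j ∨ q = k) := by
  by_cases h : 2 * (q - p) ≤ n
  · by_cases h' : p + max ((n + 1) / 2) (q - p + 1) < n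
    · exact ⟨p, q, p + max ((n + 1) / 2) (q - p + 1), by constructor <;> omega, by simp, by simp⟩
    · exact ⟨p + max ((n + 1) / 2) (q - p + 1) - n, p, q, by constructor <;> omega, by simp,
        by simp⟩
  · exact ⟨p, (p + q) / 2, q, by constructor <;> omega, by simp, by simp⟩

variable {V : Type*} {G : SimpleGraph V} [Fintype V] [DecidableRel G.Adj]

theorem finite_setOf_isThreadAt (v : V) : {l : List V | IsThreadAt G v l}.Finite := by
  classical
  have : Finite {l : List V // l.Nodup} := inferInstance
  exact (Set.finite_coe_iff.1 this).subset fun l hl => hl.2.2.1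

/-- One vertex from every thread except a fixed `l₀` suffices, since two distinct threads are not
both `l₀`. -/
theorem exists_finset_meets_threads (v : V) :
    ∃ F : Finset V, F.card ≤ numThreads G v - 1 ∧
      ∀ l₁ l₂, IsThreadAt G v l₁ → IsThreadAt G v l₂ → l₁ ≠ l₂ → ∃ s ∈ F, s ∈ l₁ ∨ s ∈ l₂ := by
  classical
  have hfin := finite_setOf_isThreadAt (G := G) v
  by_cases hne : ∃ l₀, IsThreadAt G v l₀
  swap
  · exact ⟨∅, by simp, fun l₁ _ h₁ => absurd ⟨l₁, h₁⟩ hne⟩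
  obtain ⟨l₀, h₀⟩ := hne
  have hex : ∀ l, ∃ x, IsThreadAt G v l → x ∈ l := by
    intro l
    by_cases hl : IsThreadAt G v l
    · obtain ⟨-, -, -, -, w, hw, -⟩ := hl
      exact ⟨w, fun _ => List.mem_of_getLast? hw⟩
    · exact ⟨v, fun h => absurd h hl⟩
  choose e he using hex
  refine ⟨(hfin.toFinset.erase l₀).image e, ?_, ?_⟩
  · refine Finset.card_image_le.trans ?_
    rw [Finset.card_erase_of_mem (hfin.mem_toFinset.2 h₀), numThreads,
      Set.ncard_eq_toFinset_card _ hfin]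
  · intro l₁ l₂ h₁ h₂ hne
    by_cases h : l₁ = l₀
    · exact ⟨e l₂, Finset.mem_image_of_mem _ (Finset.mem_erase.2
        ⟨fun h' => hne (h.trans h'.symm), hfin.mem_toFinset.2 h₂⟩), Or.inr (he _ h₂)⟩
    · exact ⟨e l₁, Finset.mem_image_of_mem _ (Finset.mem_erase.2
        ⟨h, hfin.mem_toFinset.2 h₁⟩), Or.inl (he _ h₁)⟩

theorem exists_meetsThreads (G : SimpleGraph V) [DecidableRel G.Adj] :
    ∃ S : Finset V, S.card ≤ threadExcess G ∧ MeetsThreads G S := by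
  classical
  choose F hF hF' using exists_finset_meets_threads (G := G)
  refine ⟨(Finset.univ.filter fun v => 1 < numThreads G v).biUnion F,
    Finset.card_biUnion_le.trans (Finset.sum_le_sum fun v _ => hF v), ?_⟩
  intro v l₁ l₂ h₁ h₂ hne
  obtain ⟨s, hs, h⟩ := hF' v l₁ l₂ h₁ h₂ hne
  refine ⟨s, Finset.mem_biUnion.2 ⟨v, Finset.mem_filter.2 ⟨Finset.mem_univ _, ?_⟩, hs⟩, h⟩
  exact (Set.one_lt_ncard (finite_setOf_isThreadAt v)).2 ⟨l₁, h₁, l₂, h₂, hne⟩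

/-- Choose two positions, branch-active as far as possible, extend them to a geodesic triple, and
keep only the vertices of the triple that are not branch-active. -/
theorem exists_finset_triple (hG : IsCactus G) {C : G.Subgraph} (hC : IsCycleSubgraph G C) :
    ∃ F : Finset V, (F.card : ℤ) ≤ max (2 - (numBranchActive G C : ℤ)) 0 + 1 ∧
      ∃ n c, IsBlock G n c ∧ 3 ≤ n ∧ C.verts = Set.range c ∧ C.edgeSet = blockEdges c ∧
        ∃ i j k, IsGeodesicTriple n i j k ∧
          ∀ t, t = i ∨ t = j ∨ t = k → c t ∈ F ∨ IsBranchActive G C (c t) := by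
  classical
  obtain ⟨n, c, h, hn, hV, hE⟩ := exists_block_of_isCycleSubgraph hG hC
  set A := (Finset.range n).filter fun t => IsBranchActive G C (c t) with hA
  have hb : numBranchActive G C ≤ A.card := by
    rw [numBranchActive]
    refine le_trans ?_ (Finset.card_image_le (f := c))
    rw [← Set.ncard_coe_finset]
    refine Set.ncard_le_ncard ?_ (Set.toFinite _)
    intro v hv
    have hvC := hv.1
    rw [hV] at hvC
    obtain ⟨t, rfl⟩ := hvC
    refine Finset.mem_coe.2 (Finset.mem_image.2 ⟨t % n, ?_, h.apply_mod t⟩)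
    rw [hA, Finset.mem_filter, h.apply_mod]
    exact ⟨Finset.mem_range.2 (Nat.mod_lt _ h.pos), hv⟩
  have hpq : ∃ p q, p < q ∧ q < n ∧ min A.card 2 ≤ (({p, q} : Finset ℕ) ∩ A).card := by
    rcases Nat.lt_or_ge 1 A.card with h1 | h1
    · obtain ⟨p, hp, q, hq, hne⟩ := Finset.one_lt_card.1 h1
      have hp' := Finset.mem_range.1 (Finset.mem_filter.1 hp).1
      have hq' := Finset.mem_range.1 (Finset.mem_filter.1 hq).1
      rcases hne.lt_or_gt with hlt | hlt
      · refine ⟨p, q, hlt, hq', ?_⟩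
        rw [Finset.inter_eq_left.2 (by simp [Finset.insert_subset_iff, hp, hq]),
          Finset.card_pair hlt.ne]
        exact min_le_right _ _
      · refine ⟨q, p, hlt, hp', ?_⟩
        rw [Finset.inter_eq_left.2 (by simp [Finset.insert_subset_iff, hp, hq]),
          Finset.card_pair hlt.ne]
        exact min_le_right _ _
    · rcases A.eq_empty_or_nonempty with h0 | ⟨p, hp⟩
      · exact ⟨0, 1, by omega, by omega, by rw [h0]; simp⟩
      · have hp' := Finset.mem_range.1 (Finset.mem_filter.1 hp).1
        rcases Nat.eq_zero_or_pos p with rfl | hp0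
        · refine ⟨0, 1, by omega, by omega, le_trans (by omega) (Finset.card_pos.2 ⟨0, ?_⟩)⟩
          simp [hp]
        · refine ⟨0, p, hp0, hp', le_trans (by omega) (Finset.card_pos.2 ⟨p, ?_⟩)⟩
          simp [hp]
  obtain ⟨p, q, hlt, hq, hcard⟩ := hpq
  obtain ⟨i, j, k, ht, hp, hq⟩ := exists_isGeodesicTriple hn hlt hq
  set T : Finset ℕ := {i, j, k} with hT
  refine ⟨(T.filter fun t => ¬ IsBranchActive G C (c t)).image c, ?_, n, c, h, hn, hV, hE,
    i, j, k, ht, fun t htt => ?_⟩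
  · have h1 := Finset.card_filter_add_card_filter_not (s := T) fun t => IsBranchActive G C (c t)
    have h2 : T.card = 3 := by
      have := ht.lt₁
      have := ht.lt₂
      exact Finset.card_eq_three.2 ⟨i, j, k, by omega, by omega, by omega, rfl⟩
    have h3 : (({p, q} : Finset ℕ) ∩ A).card ≤
        (T.filter fun t => IsBranchActive G C (c t)).card := by
      refine Finset.card_le_card fun t htt => ?_
      rw [Finset.mem_inter, Finset.mem_insert, Finset.mem_singleton] at htt
      rw [Finset.mem_filter, hT, Finset.mem_insert, Finset.mem_insert, Finset.mem_singleton]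
      refine ⟨?_, (Finset.mem_filter.1 htt.2).2⟩
      rcases htt.1 with rfl | rfl
      · exact hp
      · exact hq
    have h4 := Finset.card_image_le (s := T.filter fun t => ¬ IsBranchActive G C (c t)) (f := c)
    omega
  · by_cases hba : IsBranchActive G C (c t)
    · exact Or.inr hba
    · refine Or.inl (Finset.mem_image_of_mem _ (Finset.mem_filter.2 ⟨?_, hba⟩))
      rw [hT, Finset.mem_insert, Finset.mem_insert, Finset.mem_singleton]
      exact htt

theorem exists_hasTriples (hG : IsCactus G) :
    ∃ S : Finset V, (S.card : ℤ) ≤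
        ∑ C ∈ cycles G, max (2 - (numBranchActive G C : ℤ)) 0 + ((cycles G).card : ℤ) ∧
      HasTriples G S := by
  classical
  have hmem : ∀ C, C ∈ cycles G ↔ IsCycleSubgraph G C := by simp [cycles]
  have hex : ∀ C : G.Subgraph, ∃ F : Finset V, IsCycleSubgraph G C → (F.card : ℤ) ≤ _ ∧ _ :=
    fun C => by
      by_cases hC : IsCycleSubgraph G C
      · obtain ⟨F, hF⟩ := exists_finset_triple hG hC
        exact ⟨F, fun _ => hF⟩
      · exact ⟨∅, fun h => absurd h hC⟩
  choose F hF using hex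
  refine ⟨(cycles G).biUnion F, ?_, fun C hC => ?_⟩
  · have h1 : (((cycles G).biUnion F).card : ℤ) ≤ ∑ C ∈ cycles G, ((F C).card : ℤ) := by
      exact_mod_cast Finset.card_biUnion_le
    refine h1.trans ((Finset.sum_le_sum fun C hC => (hF C ((hmem C).1 hC)).1).trans ?_)
    rw [Finset.sum_add_distrib]
    simp
  · obtain ⟨n, c, h, hn, hV, hE, i, j, k, ht, hact⟩ := (hF C hC).2
    refine ⟨n, c, h, hn, hV, hE, i, j, k, ht, fun t htt => ?_⟩
    exact (hact t htt).imp_left fun hs => Finset.mem_biUnion.2 ⟨C, (hmem C).2 hC, hs⟩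

theorem MeetsThreads.mono {S T : Finset V} (h : MeetsThreads G S) (hST : S ⊆ T) :
    MeetsThreads G T := by
  intro v l₁ l₂ h₁ h₂ hne
  obtain ⟨s, hs, h⟩ := h v l₁ l₂ h₁ h₂ hne
  exact ⟨s, hST hs, h⟩

theorem HasTriples.mono {S T : Finset V} (h : HasTriples G S) (hST : S ⊆ T) :
    HasTriples G T := by
  intro C hC
  obtain ⟨n, c, h, hn, hV, hE, i, j, k, ht, hact⟩ := h C hC
  exact ⟨n, c, h, hn, hV, hE, i, j, k, ht, fun t htt => (hact t htt).imp_left fun hs => hST hs⟩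

end Construction

end CactusDim

/-! ### The two bounds -/

theorem mainTheorem4 {V : Type*} [Fintype V] (G : SimpleGraph V)
    [DecidableRel G.Adj] (hG : CactusDim.IsCactus G)
    (hpath : ∀ n : ℕ, 2 ≤ n → IsEmpty (G ≃g SimpleGraph.pathGraph n)) :
    (CactusDim.metricDim G : ℤ) ≤
        (CactusDim.threadExcess G : ℤ)
          + ∑ C ∈ CactusDim.cycles G, max (2 - (CactusDim.numBranchActive G C : ℤ)) 0
          + ((CactusDim.cycles G).card : ℤ) ∧
      (CactusDim.edgeMetricDim G : ℤ) ≤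
        (CactusDim.threadExcess G : ℤ)
          + ∑ C ∈ CactusDim.cycles G, max (2 - (CactusDim.numBranchActive G C : ℤ)) 0
          + ((CactusDim.cycles G).card : ℤ) := by
  classical
  obtain ⟨S, hS, hT⟩ := CactusDim.exists_meetsThreads G
  obtain ⟨S', hS', hC⟩ := CactusDim.exists_hasTriples hG
  have hT := hT.mono (Finset.subset_union_left (s₂ := S'))
  have hC := hC.mono (Finset.subset_union_right (s₁ := S))
  have hcard := Finset.card_union_le S S'
  have h1 : CactusDim.metricDim G ≤ (S ∪ S').card :=
    Nat.sInf_le ⟨_, CactusDim.isMetricGenerator_of_hasTriples hG hT hC hpath, rfl⟩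
  have h2 : CactusDim.edgeMetricDim G ≤ (S ∪ S').card :=
    Nat.sInf_le ⟨_, CactusDim.isEdgeMetricGenerator_of_hasTriples hG hT hC hpath, rfl⟩
  constructor <;> omega
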